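/- Let $K$ be a field, $N$ a lattice of finite rank, $M=\operatorname{Hom}(N,\mathbb Z)$, $N_{\mathbb R}=N\otimes\mathbb R$, $M_{\mathbb R}=M\otimes\mathbb R$. Let $\Sigma$ be a fan in $N_{\mathbb R}$ (a finite nonempty collection of strongly convex rational polyhedral cones, closed under taking faces, any two of which meet in a common face) and let $X_\Sigma$ be the associated toric variety over $K$, obtained by gluing the affine varieties $U_\sigma=\operatorname{Spec}K[\sigma^\vee\cap M]$, $\sigma\in\Sigma$, along the open subvarieties $U_{\sigma\cap\sigma'}$. Assume that $X_\Sigma$ is smooth and proper over $K$. Let $X_0=\operatorname{Spec}K[M]\subseteq X_\Sigma$ be the dense open orbit, and let $\Sigma^{(1)}$ be the set of one-dimensional cones of $\Sigma$; for $\tau\in\Sigma^{(1)}$ let $v_\tau\in N$ be the generator of the monoid $\tau\cap N$ and let $V(\tau)\subseteq X_\Sigma$ be the closure of the torus orbit corresponding to $\tau$. Let $f=\sum_m c_m\chi^m\in K[M]$ be a nonzero Laurent polynomial, $\tilde f$ the rational function on $X_\Sigma$ which restricts to $f$ on $X_0$, $V(f)\subseteq X_0$ the closed subscheme defined by $f$,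 and $[\overline{V(f)}]$ the cycle on $X_\Sigma$ of its scheme-theoretic closure (the sum of the irreducible components, each counted with its multiplicity). Let $\operatorname{NP}(f)\subseteq M_{\mathbb R}$ be the convex hull of $\{m\in M: c_m\neq 0\}$, and $\Psi_{\operatorname{NP}(f)}(u)=\min_{x\in\operatorname{NP}(f)}\langle x,u\rangle$ for $u\in N_{\mathbb R}$. Then $\Psi_{\operatorname{NP}(f)}(v_\tau)$ is an integer for every $\tau\in\Sigma^{(1)}$, and $$\operatorname{div}(\tilde f)=\big[\overline{V(f)}\big]+\sum_{\tau\in\Sigma^{(1)}}\Psi_{\operatorname{NP}(f)}(v_\tau)\,V(\tau).$$ In particular, $[\overline{V(f)}]$ is rationally equivalent to the cycle $-\sum_{\tau\in\Sigma^{(1)}}\Psi_{\operatorname{NP}(f)}(v_\tau)\,V(\tau)$ on $X_\Sigma$. -/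

import Mathlib

open CategoryTheory CategoryTheory.Limits AlgebraicGeometry TopologicalSpace
open scoped TensorProduct

universe u

namespace Toric

noncomputable section

section Lattice

variable (N : Type u) [AddCommGroup N]

/-- The real vector space `N_ℝ = ℝ ⊗ N`. -/
abbrev NReal : Type u := ℝ ⊗[ℤ] N

/-- The dual lattice `M = Hom(N, ℤ)`. -/
abbrev CharLattice : Type u := Module.Dual ℤ N

variable {N}

/-- The canonical map `N → N_ℝ`. -/
def latticeMap : N →ₗ[ℤ] NReal N := TensorProduct.mk ℤ ℝ N 1

/-- The linear form on `N_ℝ` given by `m ∈ M`, that is the image of `m` in `M_ℝ = (N_ℝ)^*`. -/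
def charReal (m : CharLattice N) : Module.Dual ℝ (NReal N) :=
  Module.Dual.baseChange ℝ m

theorem charReal_tmul (m : CharLattice N) (a : ℝ) (v : N) :
    charReal m (a ⊗ₜ[ℤ] v) = a * (m v : ℝ) := by
  simp [charReal, Module.Dual.baseChange_apply_tmul, mul_comm]

theorem charReal_latticeMap (m : CharLattice N) (v : N) :
    charReal m (latticeMap v) = (m v : ℝ) := by
  have := charReal_tmul m 1 v
  rwa [one_mul] at this

theorem charReal_zero : charReal (0 : CharLattice N) = 0 := by
  simp [charReal]

theorem charReal_add (m m' : CharLattice N) :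
    charReal (m + m') = charReal m + charReal m' := by
  simp [charReal]

/-- The monoid `σ^∨ ∩ M`. -/
def dualMonoid (σ : PointedCone ℝ (NReal N)) : AddSubmonoid (CharLattice N) where
  carrier := {m | ∀ u ∈ σ, 0 ≤ charReal m u}
  zero_mem' := fun u _ => by simp [charReal_zero]
  add_mem' := fun {a b} ha hb u hu => by
    simpa [charReal_add] using add_nonneg (ha u hu) (hb u hu)

theorem mem_dualMonoid {σ : PointedCone ℝ (NReal N)} {m : CharLattice N} :
    m ∈ dualMonoid σ ↔ ∀ u ∈ σ, 0 ≤ charReal m u := Iff.rfl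

theorem dualMonoid_anti {τ σ : PointedCone ℝ (NReal N)} (h : τ ≤ σ) :
    dualMonoid σ ≤ dualMonoid τ := fun _ hm u hu => hm u (h hu)

theorem mem_dualMonoid_bot (m : CharLattice N) :
    m ∈ dualMonoid (⊥ : PointedCone ℝ (NReal N)) := by
  intro u hu
  rw [(Submodule.mem_bot _).1 hu, map_zero]

/-- The intersection `σ ∩ m^⊥`. When `m ∈ σ^∨ ∩ M`, this is the face of `σ` cut out by `m`; every
face of a rational polyhedral cone is of this form. -/
def cutFace (σ : PointedCone ℝ (NReal N)) (m : CharLattice N) : PointedCone ℝ (NReal N) :=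
  σ ⊓ PointedCone.ofSubmodule (LinearMap.ker (charReal m))

theorem mem_cutFace {σ : PointedCone ℝ (NReal N)} {m : CharLattice N} {u : NReal N} :
    u ∈ cutFace σ m ↔ u ∈ σ ∧ charReal m u = 0 := by
  simp [cutFace]

theorem cutFace_inf {σ : PointedCone ℝ (NReal N)} {m m' : CharLattice N}
    (hm : m ∈ dualMonoid σ) (hm' : m' ∈ dualMonoid σ) :
    cutFace σ m ⊓ cutFace σ m' = cutFace σ (m + m') := by
  ext u
  simp only [Submodule.mem_inf, mem_cutFace, charReal_add, LinearMap.add_apply]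
  constructor
  · rintro ⟨⟨h, h1⟩, _, h2⟩
    exact ⟨h, by rw [h1, h2, add_zero]⟩
  · rintro ⟨h, h1⟩
    have a := hm u h
    have b := hm' u h
    exact ⟨⟨h, by linarith⟩, h, by linarith⟩

/-- Convex rational polyhedral cones: those generated by finitely many lattice vectors. -/
def IsRationalPolyhedral (σ : PointedCone ℝ (NReal N)) : Prop :=
  ∃ s : Finset N, σ = PointedCone.hull ℝ (latticeMap '' (s : Set N))

theorem mem_dualMonoid_hull {s : Set N} {m : CharLattice N} :
    m ∈ dualMonoid (PointedCone.hull ℝ (latticeMap '' s)) ↔ ∀ v ∈ s, 0 ≤ m v := by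
  constructor
  · intro h v hv
    have := h _ (PointedCone.subset_hull (Set.mem_image_of_mem _ hv))
    rw [charReal_latticeMap] at this
    exact_mod_cast this
  · intro h u hu
    induction hu using Submodule.span_induction with
    | mem x hx =>
      obtain ⟨v, hv, rfl⟩ := hx
      rw [charReal_latticeMap]
      exact_mod_cast h v hv
    | zero => simp
    | add x y _ _ hx hy => rw [map_add]; exact add_nonneg hx hy
    | smul a x _ hx =>
      have : charReal m (a • x) = (a : ℝ) * charReal m x := by
        rw [← smul_eq_mul, ← map_smul]; rfl
      rw [this]
      exact mul_nonneg a.2 hx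

end Lattice

/-- A fan in `N_ℝ`: a finite nonempty collection of strongly convex rational polyhedral cones which
contains every face of each of its cones, and in which the intersection of any two cones is a face
of each. Nonemptiness is stated as the presence of the zero cone, the smallest face of every
strongly convex cone. -/
structure Fan (N : Type u) [AddCommGroup N] where
  /-- The cones of the fan. -/
  cones : Finset (PointedCone ℝ (NReal N))
  rational : ∀ σ ∈ cones, IsRationalPolyhedral σ
  strongly_convex : ∀ σ ∈ cones, ∀ x ∈ σ, -x ∈ σ → x = 0
  bot_mem : ⊥ ∈ cones
  face_mem : ∀ σ ∈ cones, ∀ m ∈ dualMonoid σ, cutFace σ m ∈ cones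
  inter_face : ∀ σ ∈ cones, ∀ σ' ∈ cones, ∃ m ∈ dualMonoid σ, σ ⊓ σ' = cutFace σ m

namespace Fan

variable {N : Type u} [AddCommGroup N] (Δ : Fan N)

/-- The cones of a fan, as a type; it is ordered by inclusion. -/
abbrev Cone : Type u := {σ : PointedCone ℝ (NReal N) // σ ∈ Δ.cones}

/-- The zero cone of a fan. -/
def zeroCone : Δ.Cone := ⟨⊥, Δ.bot_mem⟩

theorem zeroCone_le (σ : Δ.Cone) : Δ.zeroCone ≤ σ :=
  show (⊥ : PointedCone ℝ (NReal N)) ≤ σ.1 from bot_le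

theorem exists_cutFace_of_le {τ σ : Δ.Cone} (h : τ ≤ σ) :
    ∃ m ∈ dualMonoid σ.1, τ.1 = cutFace σ.1 m := by
  obtain ⟨m, hm, e⟩ := Δ.inter_face σ.1 σ.2 τ.1 τ.2
  exact ⟨m, hm, by rw [← e, inf_eq_right.2 h]⟩

end Fan

section Charts

variable (K : Type u) [Field K] {N : Type u} [AddCommGroup N]

/-- The coordinate ring `K[σ^∨ ∩ M]` of the affine toric variety of `σ`. -/
abbrev ChartRing (σ : PointedCone ℝ (NReal N)) : Type u := AddMonoidAlgebra K (dualMonoid σ)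

/-- The inclusion `K[σ^∨ ∩ M] ⊆ K[τ^∨ ∩ M]` for `τ ⊆ σ`. -/
def chartMap {τ σ : PointedCone ℝ (NReal N)} (h : τ ≤ σ) :
    ChartRing K σ →ₐ[K] ChartRing K τ :=
  AddMonoidAlgebra.mapDomainAlgHom K K (AddSubmonoid.inclusion (dualMonoid_anti h))

theorem chartMap_single {τ σ : PointedCone ℝ (NReal N)} (h : τ ≤ σ) (m : dualMonoid σ) (c : K) :
    chartMap K h (AddMonoidAlgebra.single m c) =
      AddMonoidAlgebra.single (AddSubmonoid.inclusion (dualMonoid_anti h) m) c := by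
  simp [chartMap]

theorem chartMap_injective {τ σ : PointedCone ℝ (NReal N)} (h : τ ≤ σ) :
    Function.Injective (chartMap K h) :=
  AddMonoidAlgebra.mapDomain_injective
    (AddSubmonoid.inclusion_injective (dualMonoid_anti h))

/-- The inclusion `K[σ^∨ ∩ M] ⊆ K[M]`. -/
def chartToTorus (σ : PointedCone ℝ (NReal N)) :
    ChartRing K σ →ₐ[K] AddMonoidAlgebra K (CharLattice N) :=
  AddMonoidAlgebra.mapDomainAlgHom K K (dualMonoid σ).subtype

theorem chartToTorus_injective (σ : PointedCone ℝ (NReal N)) :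
    Function.Injective (chartToTorus K σ) :=
  AddMonoidAlgebra.mapDomain_injective Subtype.val_injective

theorem chartToTorus_bot_bijective :
    Function.Bijective (chartToTorus K (⊥ : PointedCone ℝ (NReal N))) := by
  refine ⟨chartToTorus_injective K _, fun f => ?_⟩
  induction f using AddMonoidAlgebra.induction_linear with
  | zero => exact ⟨0, map_zero _⟩
  | add f g hf hg =>
    obtain ⟨a, rfl⟩ := hf
    obtain ⟨b, rfl⟩ := hg
    exact ⟨a + b, map_add _ _ _⟩
  | single m c =>
    exact ⟨AddMonoidAlgebra.single ⟨m, mem_dualMonoid_bot m⟩ c, by simp [chartToTorus]⟩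

/-- For a face `τ` of `σ` cut out by `m ∈ σ^∨ ∩ M`, the ring `K[τ^∨ ∩ M]` is the localization of
`K[σ^∨ ∩ M]` at `χ^m`. -/
theorem isLocalization_chartMap {τ σ : PointedCone ℝ (NReal N)} (hσ : IsRationalPolyhedral σ)
    (h : τ ≤ σ) (m : dualMonoid σ) (e : τ = cutFace σ m) :
    @IsLocalization.Away _ _ (AddMonoidAlgebra.single m (1 : K)) (ChartRing K τ) _
      (chartMap K h).toRingHom.toAlgebra := by
  let _ := (chartMap K h).toRingHom.toAlgebra
  have alg : ∀ x, algebraMap (ChartRing K σ) (ChartRing K τ) x = chartMap K h x := fun _ => rfl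
  have hneg : -(m : CharLattice N) ∈ dualMonoid τ := by
    intro u hu
    rw [e, mem_cutFace] at hu
    have h0 : charReal (-(m : CharLattice N)) u + charReal (m : CharLattice N) u = 0 := by
      rw [← LinearMap.add_apply, ← charReal_add]; simp [charReal_zero]
    rw [hu.2, add_zero] at h0
    exact h0.ge
  -- clearing denominators for one character
  have key : ∀ p : dualMonoid τ, ∃ n : ℕ, ∀ k, n ≤ k →
      (p : CharLattice N) + k • (m : CharLattice N) ∈ dualMonoid σ := by
    intro p
    obtain ⟨s, hs⟩ := hσ
    have hm : ∀ v ∈ s, 0 ≤ (m : CharLattice N) v := by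
      have h2 := m.2
      generalize (m : CharLattice N) = m' at h2 ⊢
      rw [hs, mem_dualMonoid_hull] at h2
      exact fun v hv => h2 v hv
    refine ⟨∑ v ∈ s, (p.1 v).natAbs, fun k hk => ?_⟩
    suffices H : ∀ v ∈ (s : Set N), 0 ≤ ((p : CharLattice N) + k • (m : CharLattice N)) v by
      have := mem_dualMonoid_hull.2 H
      rwa [← hs] at this
    intro v hv
    have hv' : v ∈ s := hv
    rcases (hm v hv').eq_or_lt with h0 | h0
    · have hvτ : latticeMap v ∈ τ := by
        rw [e, mem_cutFace, charReal_latticeMap, ← h0]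
        refine ⟨?_, by simp⟩
        rw [hs]
        exact PointedCone.subset_hull (Set.mem_image_of_mem _ hv)
      have hp := p.2 _ hvτ
      rw [charReal_latticeMap] at hp
      have hp' : 0 ≤ p.1 v := by exact_mod_cast hp
      simp only [LinearMap.add_apply, LinearMap.smul_apply, ← h0, smul_zero, add_zero]
      exact hp'
    · have h1 : (p.1 v).natAbs ≤ k :=
        (Finset.single_le_sum (f := fun v => (p.1 v).natAbs) (fun _ _ => Nat.zero_le _) hv').trans hk
      have h2 : (k : ℤ) ≤ k * (m : CharLattice N) v := by nlinarith
      simp only [LinearMap.add_apply, LinearMap.smul_apply, nsmul_eq_mul]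
      have : -((p.1 v).natAbs : ℤ) ≤ p.1 v := by omega
      have h1' : ((p.1 v).natAbs : ℤ) ≤ k := by exact_mod_cast h1
      linarith
  have keyf : ∀ f : ChartRing K τ, ∃ n : ℕ, ∀ k, n ≤ k → ∃ g : ChartRing K σ,
      f * chartMap K h (AddMonoidAlgebra.single m (1 : K)) ^ k = chartMap K h g := by
    intro f
    induction f using AddMonoidAlgebra.induction_linear with
    | zero => exact ⟨0, fun k _ => ⟨0, by simp⟩⟩
    | add f g hf hg =>
      obtain ⟨a, ha⟩ := hf
      obtain ⟨b, hb⟩ := hg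
      refine ⟨max a b, fun k hk => ?_⟩
      obtain ⟨x, hx⟩ := ha k (le_trans (le_max_left _ _) hk)
      obtain ⟨y, hy⟩ := hb k (le_trans (le_max_right _ _) hk)
      exact ⟨x + y, by rw [add_mul, hx, hy, map_add]⟩
    | single p c =>
      obtain ⟨n, hn⟩ := key p
      refine ⟨n, fun k hk => ⟨AddMonoidAlgebra.single ⟨_, hn k hk⟩ c, ?_⟩⟩
      rw [chartMap_single, chartMap_single, AddMonoidAlgebra.single_pow,
        AddMonoidAlgebra.single_mul_single, one_pow, mul_one]
      congr 1
  constructor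
  constructor
  · rintro ⟨_, n, rfl⟩
    rw [alg]
    show IsUnit (chartMap K h (AddMonoidAlgebra.single m (1 : K) ^ n))
    rw [map_pow]
    refine IsUnit.pow _ (IsUnit.of_mul_eq_one (AddMonoidAlgebra.single ⟨_, hneg⟩ 1) ?_)
    rw [chartMap_single, AddMonoidAlgebra.single_mul_single, mul_one, AddMonoidAlgebra.one_def]
    congr 1
    ext
    simp
  · intro f
    obtain ⟨n, hn⟩ := keyf f
    obtain ⟨g, hg⟩ := hn n le_rfl
    refine ⟨⟨g, ⟨_, n, rfl⟩⟩, ?_⟩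
    rw [alg, alg, ← hg]
    show f * chartMap K h (AddMonoidAlgebra.single m (1 : K) ^ n) = _
    rw [map_pow]
  · intro x y hxy
    exact ⟨1, by rw [chartMap_injective K h hxy]⟩

end Charts

section Variety

variable (K : Type u) [Field K] {N : Type u} [AddCommGroup N] (Δ : Fan N)

/-- The diagram of the affine toric varieties `U_σ = Spec K[σ^∨ ∩ M]`, for `σ` in the fan. -/
def chartDiagram : Δ.Cone ⥤ Scheme.{u} where
  obj σ := Spec (CommRingCat.of (ChartRing K σ.1))
  map {τ σ} h := Spec.map (CommRingCat.ofHom (chartMap K (leOfHom h : τ.1 ≤ σ.1)).toRingHom)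
  map_id σ := by
    rw [← Spec.map_id]
    refine congrArg Spec.map (CommRingCat.hom_ext (RingHom.ext fun x => ?_))
    change ChartRing K _ at x
    induction x using AddMonoidAlgebra.induction_linear with
    | zero => simp
    | add f g hf hg => rw [map_add, map_add, hf, hg]
    | single m c => exact chartMap_single K (le_refl σ.1) m c
  map_comp {ρ τ σ} f g := by
    rw [← Spec.map_comp]
    refine congrArg Spec.map (CommRingCat.hom_ext (RingHom.ext fun x => ?_))
    change ChartRing K _ at x
    induction x using AddMonoidAlgebra.induction_linear with
    | zero => simp
    | add f g hf hg => rw [map_add, map_add, hf, hg]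
    | single m c =>
      have h₁ : ρ.1 ≤ τ.1 := leOfHom f
      have h₂ : τ.1 ≤ σ.1 := leOfHom g
      show chartMap K (h₁.trans h₂) _ = chartMap K h₁ (chartMap K h₂ _)
      rw [chartMap_single, chartMap_single, chartMap_single]
      rfl

theorem range_chartDiagram_map {τ σ : Δ.Cone} (h : τ ⟶ σ) (m : dualMonoid σ.1)
    (e : τ.1 = cutFace σ.1 m) :
    Set.range ((chartDiagram K Δ).map h) =
      {x : PrimeSpectrum (ChartRing K σ.1) | AddMonoidAlgebra.single m (1 : K) ∉ x.asIdeal} := by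
  have hl : (τ.1 : PointedCone ℝ (NReal N)) ≤ σ.1 := leOfHom h
  let _ := (chartMap K hl).toRingHom.toAlgebra
  have := isLocalization_chartMap K (Δ.rational _ σ.2) hl m e
  exact PrimeSpectrum.localization_away_comap_range (ChartRing K τ.1)
    (AddMonoidAlgebra.single m (1 : K))

instance isOpenImmersion_chartDiagram_map {τ σ : Δ.Cone} (h : τ ⟶ σ) :
    IsOpenImmersion ((chartDiagram K Δ).map h) := by
  have hl : (τ.1 : PointedCone ℝ (NReal N)) ≤ σ.1 := leOfHom h
  obtain ⟨m, hm, e⟩ := Δ.exists_cutFace_of_le (leOfHom h)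
  let _ := (chartMap K hl).toRingHom.toAlgebra
  have := isLocalization_chartMap K (Δ.rational _ σ.2) hl ⟨m, hm⟩ e
  exact IsOpenImmersion.of_isLocalization (R := ChartRing K σ.1) (S := ChartRing K τ.1)
    (AddMonoidAlgebra.single ⟨m, hm⟩ (1 : K))

instance isLocallyDirected_chartDiagram :
    ((chartDiagram K Δ) ⋙ Scheme.forget).IsLocallyDirected where
  cond {i j k} fi fj xi xj hx := by
    obtain ⟨m, hm, e⟩ := Δ.exists_cutFace_of_le (leOfHom fi)
    obtain ⟨m', hm', e'⟩ := Δ.exists_cutFace_of_le (leOfHom fj)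
    have hl : cutFace k.1 (m + m') ∈ Δ.cones := Δ.face_mem _ k.2 _ (add_mem hm hm')
    have hinf : cutFace k.1 (m + m') = i.1 ⊓ j.1 := by rw [e, e', cutFace_inf hm hm']
    let l : Δ.Cone := ⟨_, hl⟩
    have li : l ≤ i := by
      show cutFace k.1 (m + m') ≤ i.1
      rw [hinf]; exact inf_le_left
    have lj : l ≤ j := by
      show cutFace k.1 (m + m') ≤ j.1
      rw [hinf]; exact inf_le_right
    have hx' : (chartDiagram K Δ).map fi xi = (chartDiagram K Δ).map fj xj := hx
    have h1 : (chartDiagram K Δ).map fi xi ∈ Set.range ((chartDiagram K Δ).map fi) := ⟨_, rfl⟩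
    have h2 : (chartDiagram K Δ).map fi xi ∈ Set.range ((chartDiagram K Δ).map fj) :=
      hx' ▸ ⟨_, rfl⟩
    rw [range_chartDiagram_map K Δ fi ⟨m, hm⟩ e] at h1
    rw [range_chartDiagram_map K Δ fj ⟨m', hm'⟩ e'] at h2
    have h3 : (chartDiagram K Δ).map fi xi ∈
        Set.range ((chartDiagram K Δ).map (homOfLE li ≫ fi)) := by
      rw [range_chartDiagram_map K Δ _ ⟨m + m', add_mem hm hm'⟩ rfl]
      intro hmem
      have hs : (AddMonoidAlgebra.single (⟨m + m', add_mem hm hm'⟩ : dualMonoid k.1) (1 : K)) =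
          AddMonoidAlgebra.single ⟨m, hm⟩ 1 * AddMonoidAlgebra.single ⟨m', hm'⟩ 1 := by
        rw [AddMonoidAlgebra.single_mul_single, mul_one]; rfl
      rw [hs] at hmem
      rcases (PrimeSpectrum.isPrime _).mem_or_mem hmem with h | h
      · exact h1 h
      · exact h2 h
    obtain ⟨x, hxx⟩ := h3
    refine ⟨l, homOfLE li, homOfLE lj, x, ?_, ?_⟩
    · apply ((chartDiagram K Δ).map fi).isOpenEmbedding.injective
      rw [← hxx, Functor.map_comp]
      rfl
    · apply ((chartDiagram K Δ).map fj).isOpenEmbedding.injective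
      rw [← hx', ← hxx, ← Subsingleton.elim (homOfLE lj ≫ fj) (homOfLE li ≫ fi),
        Functor.map_comp]
      rfl

/-- The toric variety `X_Σ` over `K`: the affine toric varieties `U_σ`, `σ ∈ Σ`, glued along the
open subvarieties `U_{σ ∩ σ'}`. -/
def toricVariety : Scheme.{u} := colimit (chartDiagram K Δ)

/-- The inclusion of the affine chart `U_σ` in `X_Σ`. -/
def chartι (σ : Δ.Cone) : Spec (CommRingCat.of (ChartRing K σ.1)) ⟶ toricVariety K Δ :=
  colimit.ι (chartDiagram K Δ) σ

instance isOpenImmersion_chartι (σ : Δ.Cone) : IsOpenImmersion (chartι K Δ σ) :=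
  inferInstanceAs (IsOpenImmersion (colimit.ι (chartDiagram K Δ) σ))

/-- The open cover of `X_Σ` by the charts `U_σ`. -/
def chartCover : (toricVariety K Δ).OpenCover :=
  Scheme.IsLocallyDirected.openCover (chartDiagram K Δ)

/-- The structure morphism of `X_Σ`. -/
def structureMap : toricVariety K Δ ⟶ Spec (CommRingCat.of K) :=
  colimit.desc (chartDiagram K Δ)
    { pt := Spec (CommRingCat.of K)
      ι :=
        { app := fun σ => Spec.map (CommRingCat.ofHom (algebraMap K (ChartRing K σ.1)))
          naturality := fun τ σ h => by
            show Spec.map _ ≫ Spec.map _ = _ ≫ 𝟙 _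
            rw [← Spec.map_comp, Category.comp_id, ← CommRingCat.ofHom_comp]
            congr 2
            exact (chartMap K (leOfHom h : τ.1 ≤ σ.1)).comp_algebraMap } }

/-- The inclusion in `X_Σ` of its torus `𝕋 = Spec K[M]`, that is of the dense open orbit `X_0`. -/
def torusι : Spec (CommRingCat.of (AddMonoidAlgebra K (CharLattice N))) ⟶ toricVariety K Δ :=
  Spec.map (CommRingCat.ofHom (chartToTorus K Δ.zeroCone.1).toRingHom) ≫ chartι K Δ Δ.zeroCone

instance isOpenImmersion_torusι : IsOpenImmersion (torusι K Δ) := by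
  have : IsIso (CommRingCat.ofHom (chartToTorus K Δ.zeroCone.1).toRingHom) :=
    (ConcreteCategory.isIso_iff_bijective _).2 (chartToTorus_bot_bijective K)
  unfold torusι
  infer_instance

theorem chartι_comp {τ σ : Δ.Cone} (h : τ ≤ σ) :
    Spec.map (CommRingCat.ofHom (chartMap K h).toRingHom) ≫ chartι K Δ σ = chartι K Δ τ :=
  colimit.w (chartDiagram K Δ) (homOfLE h)

theorem torusι_eq (σ : Δ.Cone) :
    torusι K Δ = Spec.map (CommRingCat.ofHom (chartToTorus K σ.1).toRingHom) ≫ chartι K Δ σ := by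
  rw [torusι, ← chartι_comp K Δ (Δ.zeroCone_le σ), ← Category.assoc, ← Spec.map_comp]
  refine congrArg (fun φ => Spec.map φ ≫ chartι K Δ σ)
    (CommRingCat.hom_ext (RingHom.ext fun x => ?_))
  change ChartRing K _ at x
  induction x using AddMonoidAlgebra.induction_linear with
  | zero => simp
  | add f g hf hg => rw [map_add, map_add, hf, hg]
  | single m c =>
    show chartToTorus K _ (chartMap K (show Δ.zeroCone.1 ≤ σ.1 from Δ.zeroCone_le σ) _) =
      chartToTorus K _ _
    rw [chartMap_single K (show Δ.zeroCone.1 ≤ σ.1 from Δ.zeroCone_le σ)]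
    simp [chartToTorus]

end Variety

section Instances

variable (K : Type u) [Field K] {N : Type u} [AddCommGroup N] [Module.Free ℤ N]
  [Module.Finite ℤ N] (Δ : Fan N)

instance : TwoUniqueSums (CharLattice N) := by
  let b := Module.Free.chooseBasis ℤ (CharLattice N)
  exact TwoUniqueSums.of_injective_addHom b.repr.toAddMonoidHom.toAddHom b.repr.injective
    inferInstance

instance isDomain_torusRing : IsDomain (AddMonoidAlgebra K (CharLattice N)) :=
  NoZeroDivisors.to_isDomain _

instance isDomain_chartRing (σ : PointedCone ℝ (NReal N)) : IsDomain (ChartRing K σ) :=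
  (chartToTorus_injective K σ).isDomain (chartToTorus K σ).toRingHom

/-- Gordan's lemma. -/
theorem fg_dualMonoid {σ : PointedCone ℝ (NReal N)} (hσ : IsRationalPolyhedral σ) :
    AddMonoid.FG (dualMonoid σ) := by
  obtain ⟨s, rfl⟩ := hσ
  let b := Module.Free.chooseBasis ℤ (CharLattice N)
  let ι := Module.Free.ChooseBasisIndex ℤ (CharLattice N)
  let coord (a : ι ⊕ ι ⊕ s) : (ι ⊕ ι ⊕ s → ℕ) →+ ℤ :=
    (Nat.castAddMonoidHom ℤ).comp (Pi.evalAddMonoidHom (fun _ => ℕ) a)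
  let p : (ι ⊕ ι ⊕ s → ℕ) →+ CharLattice N :=
    ∑ i, (((LinearMap.toSpanSingleton ℤ _ (b i)).toAddMonoidHom).comp
      (coord (.inl i) - coord (.inr (.inl i))))
  have hp : ∀ x, p x = ∑ i, ((x (.inl i) : ℤ) - x (.inr (.inl i))) • b i := fun x => by
    simp only [p, AddMonoidHom.finsetSum_apply]
    rfl
  let f : (ι ⊕ ι ⊕ s → ℕ) →+ (s → ℤ) :=
    { toFun := fun x v => p x v.1
      map_zero' := by ext; simp
      map_add' := fun x y => by ext; simp }
  let g : (ι ⊕ ι ⊕ s → ℕ) →+ (s → ℤ) :=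
    { toFun := fun x v => (x (.inr (.inr v)) : ℤ)
      map_zero' := by ext; simp
      map_add' := fun x y => by ext; simp }
  have hfg := (AddSubmonoid.fg_eqLocusM f g).map p
  rw [AddMonoid.fg_iff_addSubmonoid_fg]
  convert hfg
  ext m
  rw [mem_dualMonoid_hull]
  constructor
  · intro h
    refine ⟨Sum.elim (fun i => (b.repr m i).toNat) (Sum.elim (fun i => (-(b.repr m i)).toNat)
      (fun v => (m v.1).toNat)), ?_, ?_⟩
    all_goals
      have hm : p (Sum.elim (fun i => (b.repr m i).toNat) (Sum.elim (fun i => (-(b.repr m i)).toNat)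
          (fun v : s => (m v.1).toNat))) = m := by
        rw [hp]
        conv_rhs => rw [← b.sum_repr m]
        refine Finset.sum_congr rfl fun i _ => ?_
        congr 1
        simp only [Sum.elim_inl, Sum.elim_inr]
        omega
    · ext v
      show p _ v.1 = ((m v.1).toNat : ℤ)
      rw [hm, Int.toNat_of_nonneg (h v.1 v.2)]
    · exact hm
  · rintro ⟨x, hx, rfl⟩ v hv
    have : p x v = (x (.inr (.inr ⟨v, hv⟩)) : ℤ) := congrFun (show f x = g x from hx) ⟨v, hv⟩
    rw [this]
    exact Int.natCast_nonneg _

theorem isNoetherianRing_chartRing {σ : PointedCone ℝ (NReal N)} (hσ : IsRationalPolyhedral σ) :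
    IsNoetherianRing (ChartRing K σ) := by
  have := fg_dualMonoid hσ
  exact Algebra.FiniteType.isNoetherianRing K _

instance isReduced_toricVariety : AlgebraicGeometry.IsReduced (toricVariety K Δ) := by
  have : ∀ i, AlgebraicGeometry.IsReduced ((chartCover K Δ).X i) := fun i =>
    inferInstanceAs (AlgebraicGeometry.IsReduced (Spec (CommRingCat.of (ChartRing K i.1))))
  exact AlgebraicGeometry.IsReduced.of_openCover _ (chartCover K Δ)

instance isLocallyNoetherian_toricVariety : IsLocallyNoetherian (toricVariety K Δ) := by
  rw [isLocallyNoetherian_iff_openCover (chartCover K Δ)]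
  intro i
  have := isNoetherianRing_chartRing K (Δ.rational _ i.2)
  exact inferInstanceAs (IsLocallyNoetherian (Spec (CommRingCat.of (ChartRing K i.1))))

theorem specializes_torusι (x : toricVariety K Δ) :
    torusι K Δ (⊥ : PrimeSpectrum (AddMonoidAlgebra K (CharLattice N))) ⤳ x := by
  obtain ⟨σ, y, rfl⟩ := Scheme.IsLocallyDirected.ι_jointly_surjective (chartDiagram K Δ) x
  have h : torusι K Δ (⊥ : PrimeSpectrum (AddMonoidAlgebra K (CharLattice N))) =
      chartι K Δ σ (⊥ : PrimeSpectrum (ChartRing K σ.1)) := by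
    rw [torusι_eq K Δ σ]
    refine congrArg (chartι K Δ σ) (?_ : PrimeSpectrum.comap (chartToTorus K σ.1).toRingHom ⊥ = ⊥)
    exact PrimeSpectrum.ext ((RingHom.injective_iff_ker_eq_bot _).1 (chartToTorus_injective K σ.1))
  rw [h]
  refine Specializes.map ?_ (chartι K Δ σ).continuous
  exact (PrimeSpectrum.le_iff_specializes (⊥ : PrimeSpectrum (ChartRing K σ.1)) y).1 bot_le

instance irreducibleSpace_toricVariety : IrreducibleSpace (toricVariety K Δ) := by
  let η := torusι K Δ (⊥ : PrimeSpectrum (AddMonoidAlgebra K (CharLattice N)))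
  have h : IsIrreducible (Set.univ : Set (toricVariety K Δ)) := by
    have hc : closure {η} = Set.univ :=
      Set.eq_univ_of_forall fun x => (specializes_torusι K Δ x).mem_closure
    rw [← hc]
    exact isIrreducible_singleton.closure
  exact { isPreirreducible_univ := h.isPreirreducible, toNonempty := ⟨η⟩ }

instance isIntegral_toricVariety : IsIntegral (toricVariety K Δ) :=
  isIntegral_of_irreducibleSpace_of_isReduced _

end Instances

section Cycles

variable {X : Scheme.{u}}

theorem finite_maximal_points (U : X.Opens) [NoetherianSpace (U : Set X)] (C : Set X) (hC : IsClosed C) :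
    {x : X | x ∈ U ∧ x ∈ C ∧ ∀ y ∈ U, y ∈ C → y ⤳ x → y = x}.Finite := by
  obtain ⟨T, hT, hcl, hirr, hS⟩ := NoetherianSpace.exists_finite_set_isClosed_irreducible
    (α := (U : Set X)) (s := Subtype.val ⁻¹' C) (hC.preimage continuous_subtype_val)
  have : Finite T := hT
  have : QuasiSober (U : Set X) := inferInstanceAs (QuasiSober U.toScheme)
  refine (Set.finite_range fun t : T => ((hirr t.1 t.2).genericPoint : (U : Set X)).1).subset ?_
  rintro x ⟨hxU, hxC, hmax⟩
  have hx : (⟨x, hxU⟩ : (U : Set X)) ∈ Subtype.val ⁻¹' C := hxC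
  rw [hS] at hx
  obtain ⟨t, ht, hxt⟩ := hx
  have hg := (hirr t ht).isGenericPoint_genericPoint (hcl t ht)
  refine ⟨⟨t, ht⟩, hmax _ (hirr t ht).genericPoint.2 ?_ ?_⟩
  · have h1 : (hirr t ht).genericPoint ∈ ⋃₀ T := ⟨t, ht, hg.mem⟩
    rw [← hS] at h1
    exact h1
  · exact (hg.specializes hxt).map continuous_subtype_val

theorem exists_noetherian_nhd [IsLocallyNoetherian X] (x : X) :
    ∃ U : X.Opens, x ∈ U ∧ IsAffineOpen U ∧ NoetherianSpace (U : Set X) := by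
  obtain ⟨_, ⟨U, hU, rfl⟩, hx, -⟩ := X.isBasis_affineOpens.exists_subset_of_mem_open
    (Set.mem_univ x) isOpen_univ
  have := IsLocallyNoetherian.component_noetherian (X := X) ⟨U, hU⟩
  exact ⟨U, hx, hU, (noetherianSpace_of_isAffineOpen U hU)⟩

theorem ord_section_eq_zero [IsIntegral X] [IsLocallyNoetherian X] {U : X.Opens} [Nonempty U]
    (a : Γ(X, U)) {x : X} (hx : x ∈ X.basicOpen a) :
    Scheme.ord (algebraMap Γ(X, U) X.functionField a) x = 0 := by
  have : Nonempty (X.basicOpen a) := ⟨⟨x, hx⟩⟩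
  have h : algebraMap Γ(X, U) X.functionField a = X.germToFunctionField (X.basicOpen a)
      (X.presheaf.map (homOfLE (X.basicOpen_le a)).op a) :=
    (TopCat.Presheaf.germ_res_apply X.presheaf (homOfLE (X.basicOpen_le a)) _ _ a).symm
  rw [h]
  exact Scheme.ord_of_isUnit (U := X.basicOpen a) (X.toRingedSpace.isUnit_res_basicOpen a) hx

theorem ord_div_eq_zero [IsIntegral X] [IsLocallyNoetherian X] {U : X.Opens} [Nonempty U]
    (a b : Γ(X, U)) (ha : a ≠ 0) (hb : b ≠ 0) {x : X} (hx : x ∈ X.basicOpen (a * b)) :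
    Scheme.ord (algebraMap Γ(X, U) X.functionField a / algebraMap Γ(X, U) X.functionField b) x
      = 0 := by
  have hinj : Function.Injective (algebraMap Γ(X, U) X.functionField) :=
    Scheme.germToFunctionField_injective X U
  have ha' := (map_ne_zero_iff _ hinj).2 ha
  have hb' := (map_ne_zero_iff _ hinj).2 hb
  rw [Scheme.basicOpen_mul] at hx
  have h := Scheme.ord_mul (x := x) (div_ne_zero ha' hb') hb'
  rw [div_mul_cancel₀ _ hb', ord_section_eq_zero a hx.1, ord_section_eq_zero b hx.2] at h
  omega

/-- The divisor of a rational function `f` on an integral locally Noetherian scheme, as a cycle: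
the coefficient of a prime divisor is the order of vanishing of `f` along it. (It is `0` for
`f = 0`.) -/
def divisor [IsIntegral X] [IsLocallyNoetherian X] (f : X.functionField) :
    AlgebraicCycle X ℤ where
  toFun := Scheme.ord f
  supportWithinDomain' := Set.subset_univ _
  supportLocallyFiniteWithinDomain' := by
    intro z _
    by_cases hf : f = 0
    · exact ⟨Set.univ, Filter.univ_mem, by simp [hf]⟩
    obtain ⟨U, hz, hU, _⟩ := exists_noetherian_nhd z
    have : Nonempty U := ⟨⟨z, hz⟩⟩
    have := functionField_isFractionRing_of_isAffineOpen X U hU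
    obtain ⟨a, b, hb, rfl⟩ := IsFractionRing.div_surjective (A := Γ(X, U)) f
    have hb0 : b ≠ 0 := nonZeroDivisors.ne_zero hb
    have ha0 : a ≠ 0 := by rintro rfl; simp at hf
    refine ⟨U, U.isOpen.mem_nhds hz, ?_⟩
    refine (finite_maximal_points U ((X.basicOpen (a * b) : Set X)ᶜ)
      (X.basicOpen (a * b)).isOpen.isClosed_compl).subset ?_
    rintro x ⟨hxU, hx⟩
    have hx1 : Order.coheight x = 1 := by
      by_contra h
      exact hx (Scheme.ord_eq_zero_of_coheight_neq_one h _)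
    refine ⟨hxU, fun hxD => hx ?_, fun y hyU hyD hyx => ?_⟩
    · exact ord_div_eq_zero a b ha0 hb0 hxD
    · by_contra hne
      have hab : a * b ≠ 0 := mul_ne_zero ha0 hb0
      have hη : genericPoint X ∈ X.basicOpen (a * b) := by
        refine ((genericPoint_spec X).mem_open_set_iff (X.basicOpen (a * b)).isOpen).2 ?_
        rw [Set.univ_inter]
        by_contra hemp
        rw [Set.not_nonempty_iff_eq_empty] at hemp
        exact hab ((basicOpen_eq_bot_iff (a * b)).1 (TopologicalSpace.Opens.ext hemp))
      have h1 : x < y := lt_of_le_not_ge (show y ⤳ x from hyx) fun h =>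
        hne (hyx.antisymm (show x ⤳ y from h)).eq
      have h2 : y < genericPoint X :=
        lt_of_le_not_ge (show genericPoint X ⤳ y from genericPoint_specializes y) fun h =>
          hyD ((show y ⤳ genericPoint X from h).mem_open (X.basicOpen (a * b)).isOpen hη)
      have h3 := Order.coheight_add_one_le h1
      have h4 := Order.coheight_add_one_le h2
      rw [hx1] at h3
      have h5 : (2 : ℕ∞) ≤ 1 := by
        calc (2 : ℕ∞) = 0 + 1 + 1 := by norm_num
          _ ≤ Order.coheight (genericPoint X) + 1 + 1 := by gcongr; exact zero_le
          _ ≤ Order.coheight y + 1 := by gcongr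
          _ ≤ 1 := h3
      exact absurd h5 (by norm_num)

/-- The fundamental cycle `[Z]` of a locally Noetherian scheme `Z`: the sum of the irreducible
components of `Z`, each counted with its multiplicity, the length of the local ring of `Z` at its
generic point. -/
def fundamentalCycle (Z : Scheme.{u}) [IsLocallyNoetherian Z] : AlgebraicCycle Z ℤ where
  toFun := by
    classical
    exact fun z => if closure {z} ∈ irreducibleComponents Z then
      ((Module.length (Z.presheaf.stalk z) (Z.presheaf.stalk z)).toNat : ℤ) else 0
  supportWithinDomain' := Set.subset_univ _
  supportLocallyFiniteWithinDomain' := by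
    intro z _
    obtain ⟨U, hz, hU, _⟩ := exists_noetherian_nhd z
    refine ⟨U, U.isOpen.mem_nhds hz, ?_⟩
    refine (finite_maximal_points U Set.univ isClosed_univ).subset ?_
    rintro x ⟨hxU, hx⟩
    refine ⟨hxU, trivial, fun y _ _ hyx => ?_⟩
    have hx' : closure {x} ∈ irreducibleComponents Z := by
      by_contra h
      exact hx (if_neg h)
    have h2 : closure {y} ≤ closure {x} :=
      hx'.2 isIrreducible_singleton.closure (specializes_iff_closure_subset.1 hyx)
    exact (hyx.antisymm (specializes_iff_closure_subset.2 h2)).eq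

/-- The push-forward of a cycle along a closed immersion (or, more generally, a quasi-compact
morphism). -/
abbrev pushforward {Z : Scheme.{u}} (i : Z ⟶ X) [QuasiCompact i] (c : AlgebraicCycle Z ℤ) :
    AlgebraicCycle X ℤ :=
  AlgebraicCycle.map i Order.height Order.height c

/-- The cycle of a closed subscheme `i : Z ⟶ X` of a locally Noetherian scheme. -/
def cycleOfClosedSubscheme [IsLocallyNoetherian X] {Z : Scheme.{u}} (i : Z ⟶ X)
    [IsClosedImmersion i] : AlgebraicCycle X ℤ :=
  have : IsLocallyNoetherian Z := LocallyOfFiniteType.isLocallyNoetherian i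
  pushforward i (fundamentalCycle Z)

/-- The cycle of an irreducible closed subset `V`: its generic point, with multiplicity one. -/
def cycleOfIrreducibleClosed (V : Set X) : AlgebraicCycle X ℤ where
  toFun := by
    classical
    exact fun x => if IsGenericPoint x V then 1 else 0
  supportWithinDomain' := Set.subset_univ _
  supportLocallyFiniteWithinDomain' := by
    intro z _
    refine ⟨Set.univ, Filter.univ_mem, Set.Subsingleton.finite ?_⟩
    rintro x ⟨-, hx⟩ y ⟨-, hy⟩
    have hx' : IsGenericPoint x V := by
      by_contra h
      exact hx (if_neg h)
    have hy' : IsGenericPoint y V := by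
      by_contra h
      exact hy (if_neg h)
    exact hx'.eq hy'

/-- Rational equivalence of cycles: `α - β` is a finite sum of cycles `i_* div(r)`, with
`i : W ⟶ X` an integral closed subscheme and `r` a nonzero rational function on `W`. -/
def RationallyEquivalent (α β : AlgebraicCycle X ℤ) : Prop :=
  α - β ∈ AddSubgroup.closure
    {c : AlgebraicCycle X ℤ | ∃ (W : Scheme.{u}) (i : W ⟶ X) (_ : IsClosedImmersion i)
      (_ : IsIntegral W) (_ : IsLocallyNoetherian W) (r : W.functionField),
      r ≠ 0 ∧ c = pushforward i (divisor r)}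

end Cycles

section Divisors

variable (K : Type u) [Field K] {N : Type u} [AddCommGroup N] [Module.Free ℤ N]
  [Module.Finite ℤ N] (Δ : Fan N)

/-- The rays of a fan, that is its cones of dimension one. -/
abbrev Fan.Ray : Type u :=
  {τ : Δ.Cone // Module.finrank ℝ (Submodule.span ℝ (τ.1 : Set (NReal N))) = 1}

instance : Fintype Δ.Ray := Fintype.ofFinite _

variable {Δ} in
/-- The semigroup `τ ∩ N` of a ray `τ` is generated by a unique nonzero vector. -/
theorem Fan.Ray.exists_generator (τ : Δ.Ray) :
    ∃ v : N, v ≠ 0 ∧ ∀ w : N, latticeMap w ∈ τ.1.1 ↔ ∃ k : ℕ, w = k • v := by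
  obtain ⟨⟨σ, hσ⟩, hdim⟩ := τ
  change Module.finrank ℝ (Submodule.span ℝ (σ : Set (NReal N))) = 1 at hdim
  show ∃ v : N, v ≠ 0 ∧ ∀ w : N, latticeMap w ∈ σ ↔ ∃ k : ℕ, w = k • v
  -- a nonzero lattice vector of the ray
  obtain ⟨w₀, hw₀σ, hw₀⟩ : ∃ w₀ : N, latticeMap w₀ ∈ σ ∧ w₀ ≠ 0 := by
    by_contra! hcon
    obtain ⟨s, hs⟩ := Δ.rational σ hσ
    have h0 : σ = ⊥ := by
      rw [hs, Submodule.span_eq_bot]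
      rintro _ ⟨v, hv, rfl⟩
      have : latticeMap v ∈ σ := by
        rw [hs]
        exact PointedCone.subset_hull (Set.mem_image_of_mem _ hv)
      rw [hcon v this, map_zero]
    rw [h0, show ((⊥ : PointedCone ℝ (NReal N)) : Set (NReal N)) = {0} from rfl,
      Submodule.span_zero_singleton, finrank_bot] at hdim
    exact zero_ne_one hdim
  obtain ⟨m, hm⟩ : ∃ m : CharLattice N, 0 < m w₀ := by
    obtain ⟨m, hm⟩ : ∃ m : CharLattice N, m w₀ ≠ 0 := by
      by_contra! hcon
      exact hw₀ ((Module.forall_dual_apply_eq_zero_iff ℤ w₀).1 hcon)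
    rcases lt_or_gt_of_ne hm with h | h
    · exact ⟨-m, by simpa using h⟩
    · exact ⟨m, h⟩
  have hu₀ : latticeMap w₀ ≠ 0 := by
    intro h
    have := charReal_latticeMap m w₀
    rw [h, map_zero] at this
    exact hm.ne (by exact_mod_cast this)
  -- every lattice vector of the ray is a nonnegative multiple of it
  have hspan : ∀ x ∈ σ, ∃ a : ℝ, x = a • latticeMap w₀ := by
    intro x hx
    obtain ⟨a, ha⟩ := exists_smul_eq_of_finrank_eq_one hdim
      (x := ⟨latticeMap w₀, Submodule.subset_span hw₀σ⟩)
      (fun h => hu₀ (congrArg Subtype.val h)) ⟨x, Submodule.subset_span hx⟩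
    exact ⟨a, (congrArg Subtype.val ha).symm⟩
  have hpos : ∀ a : ℝ, 0 ≤ a → a • latticeMap w₀ ∈ σ := fun a ha =>
    PointedCone.smul_mem σ ha hw₀σ
  have hmem : ∀ a : ℝ, a • latticeMap w₀ ∈ σ → 0 ≤ a := by
    intro a ha
    by_contra! hneg
    have h1 : -latticeMap w₀ ∈ σ := by
      have := PointedCone.smul_mem σ (inv_nonneg.2 (by linarith) : 0 ≤ (-a)⁻¹) ha
      rwa [smul_smul, inv_neg, neg_mul, inv_mul_cancel₀ hneg.ne, neg_smul, one_smul] at this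
    exact hu₀ (Δ.strongly_convex σ hσ _ hw₀σ h1)
  have hval : ∀ (w : N) (a : ℝ), latticeMap w = a • latticeMap w₀ → (m w : ℝ) = a * m w₀ := by
    intro w a h
    rw [← charReal_latticeMap, h, map_smul, charReal_latticeMap, smul_eq_mul]
  have hm' : (0 : ℝ) < m w₀ := by exact_mod_cast hm
  have hinj : ∀ w : N, latticeMap w = 0 → w = 0 := by
    intro w h
    refine (Module.forall_dual_apply_eq_zero_iff ℤ w).1 fun p => ?_
    have := charReal_latticeMap p w
    rw [h, map_zero] at this
    exact_mod_cast this.symm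
  have hex : ∃ k : ℕ, ∃ w : N, latticeMap w ∈ σ ∧ m w = k ∧ 0 < k :=
    ⟨(m w₀).toNat, w₀, hw₀σ, by omega, by omega⟩
  classical
  obtain ⟨v, hvσ, hvk, hk⟩ := Nat.find_spec hex
  set k := Nat.find hex with hkdef
  obtain ⟨b, hb⟩ := hspan _ hvσ
  refine ⟨v, ?_, fun w => ⟨fun hw => ?_, ?_⟩⟩
  · rintro rfl
    rw [map_zero] at hvk
    omega
  · obtain ⟨a, ha⟩ := hspan _ hw
    have ha0 := hmem a (ha ▸ hw)
    have hmw : 0 ≤ m w := by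
      have := hval w a ha
      have h2 : (0 : ℝ) ≤ m w := by rw [this]; positivity
      exact_mod_cast h2
    set q := (m w / k).toNat with hq
    have hqk : (q : ℤ) = m w / k := Int.toNat_of_nonneg (Int.ediv_nonneg hmw (by omega))
    have hr : latticeMap (w - q • v) = (a - q * b) • latticeMap w₀ := by
      rw [map_sub, map_nsmul, ha, hb, sub_smul, mul_smul, Nat.cast_smul_eq_nsmul]
    have hmr : m (w - q • v) = m w % k := by
      rw [map_sub, map_nsmul, hvk, nsmul_eq_mul, hqk, Int.emod_def, mul_comm]
    have hrv := hval _ _ hr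
    rw [hmr] at hrv
    have hr0 : 0 ≤ m w % k := Int.emod_nonneg _ (by omega)
    have hr1 : m w % k < k := Int.emod_lt_of_pos _ (by omega)
    have hc : 0 ≤ a - q * b := by
      by_contra! hneg
      have h1 : (a - q * b) * (m w₀ : ℝ) < 0 := mul_neg_of_neg_of_pos hneg hm'
      rw [← hrv] at h1
      have : m w % k < 0 := by exact_mod_cast h1
      omega
    have hin : latticeMap (w - q • v) ∈ σ := hr ▸ hpos _ hc
    have hzero : m w % k = 0 := by
      by_contra hne
      have := Nat.find_min' hex ⟨w - q • v, hin, (by omega : m (w - q • v) = (m w % k).toNat),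
        by omega⟩
      omega
    rw [hzero, Int.cast_zero] at hrv
    have hc0 : a - q * b = 0 := by
      rcases mul_eq_zero.1 hrv.symm with h | h
      · exact h
      · exact absurd h hm'.ne'
    rw [hc0, zero_smul] at hr
    exact ⟨q, sub_eq_zero.1 (hinj _ hr)⟩
  · rintro ⟨j, rfl⟩
    rw [map_nsmul]
    exact nsmul_mem hvσ j

variable {Δ} in
/-- The minimal nonzero lattice vector `v_τ` of a ray `τ`: the generator of the monoid `τ ∩ N`. -/
def Fan.Ray.generator (τ : Δ.Ray) : N := τ.exists_generator.choose

/-- The orbit `O(τ)` of the torus which is closed in the chart `U_τ`: it is isomorphic to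
`Spec K[τ^⊥ ∩ M]`, and its ideal in `K[τ^∨ ∩ M]` is generated by the characters `χ^m` with
`m ∉ τ^⊥`. -/
def orbit (τ : Δ.Cone) : Set (toricVariety K Δ) :=
  chartι K Δ τ '' {x : PrimeSpectrum (ChartRing K τ.1) | ∀ m : dualMonoid τ.1,
    (∃ u ∈ τ.1, charReal (m : CharLattice N) u ≠ 0) →
      AddMonoidAlgebra.single m (1 : K) ∈ x.asIdeal}

/-- The orbit closure `V(τ)`. -/
def orbitClosure (τ : Δ.Cone) : Set (toricVariety K Δ) := closure (orbit K Δ τ)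

variable {K}

instance nonempty_torusι_image : Nonempty (torusι K Δ ''ᵁ ⊤) :=
  ⟨⟨torusι K Δ (⊥ : PrimeSpectrum (AddMonoidAlgebra K (CharLattice N))), _, trivial, rfl⟩⟩

/-- The rational function `f̃` on `X_Σ` given by a Laurent polynomial `f`: the one that restricts
to `f` on the dense open orbit `Spec K[M]`. -/
def rationalFunction (f : AddMonoidAlgebra K (CharLattice N)) :
    (toricVariety K Δ).functionField :=
  (toricVariety K Δ).germToFunctionField (torusι K Δ ''ᵁ ⊤)
    (((torusι K Δ).appIso ⊤).inv
      ((Scheme.ΓSpecIso (CommRingCat.of (AddMonoidAlgebra K (CharLattice N)))).inv f))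

/-- The immersion in `X_Σ` of the closed subscheme `V(f)` of the dense open orbit. -/
def zeroSchemeι (f : AddMonoidAlgebra K (CharLattice N)) :
    Spec (CommRingCat.of (AddMonoidAlgebra K (CharLattice N) ⧸ Ideal.span {f})) ⟶
      toricVariety K Δ :=
  Spec.map (CommRingCat.ofHom (Ideal.Quotient.mk (Ideal.span {f}))) ≫ torusι K Δ

/-- The cycle of the closure of `V(f)` in `X_Σ`, that is of its scheme-theoretic image. -/
def closureCycle (f : AddMonoidAlgebra K (CharLattice N)) : AlgebraicCycle (toricVariety K Δ) ℤ :=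
  cycleOfClosedSubscheme (zeroSchemeι Δ f).imageι

/-- The Newton polytope of a Laurent polynomial `f`, in `M_ℝ = (N_ℝ)^*`. -/
def newtonPolytope (f : AddMonoidAlgebra K (CharLattice N)) : Set (Module.Dual ℝ (NReal N)) :=
  convexHull ℝ (charReal '' {m | f.coeff m ≠ 0})

/-- The support function `Ψ_B(u) = min_{x ∈ B} ⟨x, u⟩` of a nonempty convex body `B ⊆ M_ℝ`. -/
def supportFunction (B : Set (Module.Dual ℝ (NReal N))) (u : NReal N) : ℝ :=
  sInf ((fun x => x u) '' B)

end Divisors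

end

end Toric

namespace Toric

/-! ### Lengths and orders of vanishing in commutative algebra. -/

section Length

/-! The two cycles are compared point by point. The order is nonzero only at points of codimension
one, and such a point lies in the torus or is the generic point of some `V(τ)`.

In the torus the boundary terms vanish. The order of `f` at a height-one prime `p` is the length of
`K[M]_p / (f)`, which is the local ring of `V(f)` there, so it is the multiplicity of a component;
by Krull's principal ideal theorem the generic points of the components of `V(f)` are exactly its
points of codimension one in the torus (`closureCycle_zeroSchemeι_apply`). Passing to the closure
adds no component, since `V(f)` is open and dense in it (`closureCycle_of_notMem_range`).

Outside the torus, take a minimal cone `τ` whose chart contains the point. Every character of the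
chart not vanishing identically on `τ` gives a monomial that vanishes at the point, so the prime of
the point contains the ideal of the closed orbit. Height one forces equality, and `τ` is a ray
because a proper nonzero face would give a smaller nonzero prime (`exists_ray_of_coheight_eq_one`).

Along `V(τ)`, a character `t` with `t(v_τ) = 1` gives a local equation `χ^t`. Let `k` be the least
value of `m(v_τ)` over the exponents `m` of `f`. Dividing `f` by `χ^{kt}` leaves a regular function
with a term in `τ^⊥`, hence a unit at the generic point of `V(τ)`, so the order is `k`
(`Fan.Ray.ord_rationalFunction`). A linear form attains its minimum over the Newton polytope at an
exponent, so `k` is the value of the support function. -/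

theorem ord_ringEquiv {A B : Type*} [CommRing A] [CommRing B] (e : A ≃+* B) (a : A) :
    Ring.ord B (e a) = Ring.ord A a := by
  -- The length of `A ⧸ (a)` is the coheight of `(a)` among the ideals, which an isomorphism of
  -- ideal lattices preserves.
  rw [Ring.ord, Ring.ord, Module.length_quotient, Module.length_quotient,
    ← Order.coheight_orderIso e.idealComapOrderIso]
  congr 1
  ext x
  simp [RingEquiv.idealComapOrderIso, Ideal.mem_span_singleton, map_dvd_iff]

theorem length_self_ringEquiv {A B : Type*} [CommRing A] [CommRing B] (e : A ≃+* B) :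
    Module.length A A = Module.length B B := by
  rw [← Ring.ord_zero, ← Ring.ord_zero, ← ord_ringEquiv e, map_zero]

/-- Here `B` is `A ⧸ (a)`, and along a surjection lengths over `B` and over `A` agree. -/
theorem length_self_of_ker_eq_span {A B : Type*} [CommRing A] [CommRing B] (ψ : A →+* B)
    (hψ : Function.Surjective ψ) {a : A} (hker : RingHom.ker ψ = Ideal.span {a}) :
    Module.length B B = Ring.ord A a := by
  let _ := ψ.toAlgebra
  rw [← Module.length_eq_of_surjective (S := A) (R := B) (M := B) hψ, Ring.ord]
  have hker' : LinearMap.ker (Algebra.linearMap A B) = Ideal.span {a} := hker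
  rw [← hker']
  exact ((Algebra.linearMap A B).quotKerEquivOfSurjective hψ).length_eq.symm

/-- The multiplicity of a hypersurface `f = 0` at a point is the order of vanishing of `f`. -/
theorem length_localization_quotient_span {A : Type*} [CommRing A] (f : A)
    (q : PrimeSpectrum (A ⧸ Ideal.span {f})) (p : PrimeSpectrum A)
    (h : p = PrimeSpectrum.comap (Ideal.Quotient.mk (Ideal.span {f})) q) :
    Module.length (Localization.AtPrime q.asIdeal) (Localization.AtPrime q.asIdeal) =
      Ring.ord (Localization.AtPrime p.asIdeal) (algebraMap A _ f) := by
  subst h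
  -- The complement of `p` maps onto that of `q`, so localization commutes with the quotient: `A_p →
  -- (A/f)_q` is surjective with kernel generated by `f`.
  have hT : Submonoid.map (Ideal.Quotient.mk (Ideal.span {f}))
      (PrimeSpectrum.comap (Ideal.Quotient.mk (Ideal.span {f})) q).asIdeal.primeCompl =
      q.asIdeal.primeCompl := by
    ext x
    obtain ⟨x, rfl⟩ := Ideal.Quotient.mk_surjective x
    constructor
    · rintro ⟨y, hy, hxy⟩
      rw [← hxy]
      exact hy
    · exact fun hx => ⟨x, hx, rfl⟩
  have hle := Submonoid.map_le_iff_le_comap.1 hT.le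
  refine length_self_of_ker_eq_span (IsLocalization.map _ _ hle) ?_ ?_
  · intro z
    obtain ⟨x, s, rfl⟩ := IsLocalization.exists_mk'_eq q.asIdeal.primeCompl z
    obtain ⟨x, rfl⟩ := Ideal.Quotient.mk_surjective x
    obtain ⟨s, hs⟩ := s
    obtain ⟨s, rfl⟩ := Ideal.Quotient.mk_surjective s
    exact ⟨IsLocalization.mk' _ x ⟨s, hs⟩, by rw [IsLocalization.map_mk']⟩
  · rw [IsLocalization.ker_map _ _ hT, Ideal.mk_ker, Ideal.map_span, Set.image_singleton]

theorem eq_of_le_of_height_eq_one {A : Type*} [CommRing A] [IsDomain A] {I P : Ideal A}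
    [P.IsPrime] (hP : P.height = 1) (hI : I.IsPrime) (hI0 : I ≠ ⊥) (hle : I ≤ P) : I = P := by
  by_contra hcon
  have h := Ideal.height_add_one_le_of_lt_of_isPrime (lt_of_le_of_ne hle hcon)
  rw [hP] at h
  have h' : I.height + 1 ≤ 0 + 1 := by rwa [zero_add]
  exact hI0 (Ideal.height_eq_zero_iff_eq_bot.1
    (le_zero_iff.1 ((ENat.add_le_add_iff_right ENat.one_ne_top).1 h')))

end Length

/-! ### Stalks, rational functions and orders on affine charts. -/

section OpenImmersion

variable {X : Scheme.{u}}

instance isPrime_asIdeal {R : CommRingCat.{u}} (p : Spec R) : p.asIdeal.IsPrime :=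
  PrimeSpectrum.isPrime p

/-- The stalk of a scheme at a point of an affine chart. -/
noncomputable def stalkEquiv {R : CommRingCat.{u}} (i : Spec R ⟶ X) [IsOpenImmersion i]
    (p : Spec R) :
    X.presheaf.stalk (i p) ≃+* Localization.AtPrime p.asIdeal :=
  let _ : Algebra R ((Spec R).presheaf.stalk p) := StructureSheaf.stalkAlgebra R p
  have : IsLocalization.AtPrime ((Spec R).presheaf.stalk p) p.asIdeal :=
    StructureSheaf.IsLocalization.to_stalk R p
  (asIso (i.stalkMap p)).commRingCatIsoToRingEquiv.trans
    (IsLocalization.algEquiv p.asIdeal.primeCompl ((Spec R).presheaf.stalk p)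
      (Localization.AtPrime p.asIdeal)).toRingEquiv

/-- The rational function given by a function on an affine chart. -/
noncomputable def chartFunction [IrreducibleSpace X] {R : CommRingCat.{u}} (i : Spec R ⟶ X)
    [IsOpenImmersion i] [Nonempty (i ''ᵁ ⊤)] : R →+* X.functionField :=
  ((Scheme.ΓSpecIso R).inv ≫ (i.appIso ⊤).inv ≫ X.germToFunctionField (i ''ᵁ ⊤)).hom

/-- Restriction to a smaller chart keeps the germ at the generic point. This carries a Laurent
polynomial from the torus to the chart of a ray. -/
theorem chartFunction_comp [IrreducibleSpace X] {R S : CommRingCat.{u}} (i : Spec R ⟶ X)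
    [IsOpenImmersion i] [Nonempty (i ''ᵁ ⊤)] (j : Spec S ⟶ X) [IsOpenImmersion j]
    [Nonempty (j ''ᵁ ⊤)] (φ : R ⟶ S) (h : Spec.map φ ≫ i = j) (a : R) :
    chartFunction j (φ a) = chartFunction i a := by
  have hle : j ''ᵁ ⊤ ≤ i ''ᵁ ⊤ := by
    rintro _ ⟨y, -, rfl⟩
    exact ⟨Spec.map φ y, trivial, by rw [← h]; rfl⟩
  have key : (i.appIso ⊤).inv ≫ X.presheaf.map (homOfLE hle).op =
      (Spec.map φ).appTop ≫ (j.appIso ⊤).inv := by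
    rw [← cancel_mono (j.appIso ⊤).hom, Category.assoc, Category.assoc, Iso.inv_hom_id,
      Category.comp_id, Scheme.Hom.appIso_hom', Scheme.Hom.map_appLE]
    generalize Spec.map φ = k at h
    subst h
    rw [← cancel_epi (i.appIso ⊤).hom, Iso.hom_inv_id_assoc, Scheme.Hom.appIso_hom',
      Scheme.Hom.appTop, Scheme.Hom.app_eq_appLE]
    exact (Scheme.Hom.appLE_comp_appLE k i (i ''ᵁ ⊤) ⊤ ⊤ _ _).symm
  have key' : φ ≫ (Scheme.ΓSpecIso S).inv ≫ (j.appIso ⊤).inv ≫ X.germToFunctionField (j ''ᵁ ⊤) =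
      (Scheme.ΓSpecIso R).inv ≫ (i.appIso ⊤).inv ≫ X.germToFunctionField (i ''ᵁ ⊤) := by
    rw [← Category.assoc φ, Scheme.ΓSpecIso_inv_naturality, Category.assoc,
      ← Category.assoc (Spec.map φ).appTop, ← key, Category.assoc]
    congr 2
    exact TopCat.Presheaf.germ_res X.presheaf _ _ _
  exact congr($key' a)

theorem stalkEquiv_germ {R : CommRingCat.{u}} (i : Spec R ⟶ X) [IsOpenImmersion i]
    (p : Spec R) (hp : i p ∈ i ''ᵁ ⊤) (a : R) :
    stalkEquiv i p (X.presheaf.germ (i ''ᵁ ⊤) (i p) hp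
      ((i.appIso ⊤).inv ((Scheme.ΓSpecIso R).inv a))) = algebraMap R _ a := by
  let _ : Algebra R ((Spec R).presheaf.stalk p) := StructureSheaf.stalkAlgebra R p
  have : IsLocalization.AtPrime ((Spec R).presheaf.stalk p) p.asIdeal :=
    StructureSheaf.IsLocalization.to_stalk R p
  have h1 : i.stalkMap p (X.presheaf.germ (i ''ᵁ ⊤) (i p) hp
      ((i.appIso ⊤).inv ((Scheme.ΓSpecIso R).inv a))) =
      algebraMap R ((Spec R).presheaf.stalk p) a := by
    rw [Scheme.Hom.germ_stalkMap_apply, Scheme.Hom.appIso_inv_app_apply]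
    exact TopCat.Presheaf.germ_res_apply' (Spec R).presheaf _ p _ _
  show (IsLocalization.algEquiv p.asIdeal.primeCompl ((Spec R).presheaf.stalk p)
      (Localization.AtPrime p.asIdeal)) (i.stalkMap p _) = _
  rw [h1]
  exact AlgEquiv.commutes _ a

theorem coheight_chart {R : CommRingCat.{u}} (i : Spec R ⟶ X) [IsOpenImmersion i]
    (p : Spec R) : Order.coheight (i p) = p.asIdeal.height := by
  rw [coheight_eq_of_isOpenImmersion, idealHeight_eq_coheight]

/-- The stalk is `R_p`, so the order is a length over `R_p`. In dimension at most one it is finite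
for `a ≠ 0`, so `toNat` loses nothing. -/
theorem ord_chartFunction [IsIntegral X] [IsLocallyNoetherian X] {R : CommRingCat.{u}} [IsDomain R]
    (i : Spec R ⟶ X) [IsOpenImmersion i] [Nonempty (i ''ᵁ ⊤)] (p : Spec R)
    (hp : p.asIdeal.height = 1) {a : R} (ha : a ≠ 0) :
    Scheme.ord (chartFunction i a) (i p) =
      ((Ring.ord (Localization.AtPrime p.asIdeal) (algebraMap R _ a)).toNat : ℤ) := by
  have hx : Order.coheight (i p) = 1 := by rw [coheight_chart, hp]
  have : Ring.KrullDimLE 1 (X.presheaf.stalk (i p)) := krullDimLE_of_coheight_le hx.le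
  have hmem : i p ∈ i ''ᵁ ⊤ := ⟨p, trivial, rfl⟩
  set s := X.presheaf.germ (i ''ᵁ ⊤) (i p) hmem ((i.appIso ⊤).inv ((Scheme.ΓSpecIso R).inv a))
    with hs
  have hsa : stalkEquiv i p s = algebraMap R _ a := stalkEquiv_germ i p hmem a
  have hs0 : s ≠ 0 := by
    intro h
    rw [h, map_zero] at hsa
    exact ha ((FaithfulSMul.algebraMap_eq_zero_iff R (Localization.AtPrime p.asIdeal)).1 hsa.symm)
  have hfs : chartFunction i a = algebraMap (X.presheaf.stalk (i p)) X.functionField s :=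
    (Scheme.algebraMap_germ_eq_germToFunctionField X hmem _).symm
  have hf0 : chartFunction i a ≠ 0 := by
    rw [hfs]
    exact (map_ne_zero_iff _ (FaithfulSMul.algebraMap_injective _ _)).2 hs0
  have hs' := mem_nonZeroDivisors_of_ne_zero hs0
  rw [Scheme.ord_eq_iff hx hf0, hfs, ← hsa, ord_ringEquiv]
  rw [Scheme.ordHom, Ring.ordFrac_eq_ord _ hs0]
  exact Ring.ordMonoidWithZeroHom_eq_coe _ hs' (ENat.natCast_toNat (Ring.ord_ne_top hs')).symm

end OpenImmersion

/-! ### Maximal points and push-forward of cycles. -/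

section Cycles

variable {X Z : Scheme.{u}}

theorem mem_irreducibleComponents_closure_iff (z : Z) :
    closure {z} ∈ irreducibleComponents Z ↔ ∀ y : Z, y ⤳ z → y = z := by
  constructor
  · intro h y hy
    have h2 : closure {y} ≤ closure {z} :=
      h.2 isIrreducible_singleton.closure (specializes_iff_closure_subset.1 hy)
    exact (hy.antisymm (specializes_iff_closure_subset.2 h2)).eq
  · intro h
    refine ⟨isIrreducible_singleton.closure, fun C hC hle => ?_⟩
    -- By sobriety an irreducible set containing `z` lies in the closure of one point, which
    -- specializes to `z`.
    obtain ⟨y, hy⟩ := QuasiSober.sober hC.closure isClosed_closure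
    have hyz : y ⤳ z := by
      rw [specializes_iff_closure_subset, hy.def]
      exact hle.trans subset_closure
    rw [← h y hyz, hy.def]
    exact subset_closure

theorem residueDegree_of_isClosedImmersion (i : Z ⟶ X) [IsClosedImmersion i] (z : Z) :
    i.residueDegree z = 1 := by
  have hsurj : Function.Surjective (i.residueFieldMap z).hom :=
    Ideal.Quotient.lift_surjective_of_surjective _ _
      ((IsLocalRing.residue_surjective).comp (i.stalkMap_surjective z))
  let _ := (i.residueFieldMap z).hom.toAlgebra
  show Module.finrank (X.residueField (i z)) (Z.residueField z) = 1
  rw [← (LinearEquiv.ofBijective (Algebra.linearMap (X.residueField (i z)) (Z.residueField z))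
    ⟨(i.residueFieldMap z).hom.injective, hsurj⟩).finrank_eq]
  exact Module.finrank_self _

/-- Points are ordered by specialization, and everything below `i z` stays in the closed image of
`Z`. -/
theorem height_of_isClosedImmersion (i : Z ⟶ X) [IsClosedImmersion i] (z : Z) :
    Order.height (i z) = Order.height z := by
  have hle : ∀ a b : Z, i a ≤ i b ↔ a ≤ b := fun a b =>
    i.isClosedEmbedding.isInducing.specializes_iff
  have hmono : StrictMono i := strictMono_of_le_iff_le fun a b => (hle a b).symm
  have hlt : ∀ a b : Z, i a < i b → a < b := fun a b h =>
    lt_of_le_not_ge ((hle a b).1 h.le) fun h' => h.not_ge ((hle b a).2 h')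
  refine (Order.height_eq_of_strictMono _ hmono (fun a y hy => ?_) z).symm
  have hy' : y ∈ Set.range i :=
    (show i a ⤳ y from hy.le).mem_closed i.isClosedEmbedding.isClosed_range ⟨a, rfl⟩
  obtain ⟨b, rfl⟩ := hy'
  exact ⟨b, hlt b a hy, rfl⟩

/-- Only `z` lies over `i z`, the heights agree and the residue degree is one. -/
theorem pushforward_apply_of_isClosedImmersion (i : Z ⟶ X) [IsClosedImmersion i]
    (c : AlgebraicCycle Z ℤ) (z : Z) : pushforward i c (i z) = c z := by
  have hpre : i ⁻¹' {i z} = {z} := by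
    ext y
    exact ⟨fun h => i.isClosedEmbedding.injective h, fun h => congrArg i h⟩
  have hw : AlgebraicCycle.mapCoeff i Order.height Order.height z = 1 :=
    (if_pos (height_of_isClosedImmersion i z).symm).trans (residueDegree_of_isClosedImmersion i z)
  refine (Function.locallyFinsupp.map_apply _ _ _ _).trans ?_
  rw [hpre, finsum_mem_singleton, hw, Nat.cast_one, mul_one]

theorem pushforward_apply_of_notMem_range (i : Z ⟶ X) [QuasiCompact i]
    (c : AlgebraicCycle Z ℤ) (x : X) (hx : x ∉ Set.range i) : pushforward i c x = 0 := by
  have hpre : i ⁻¹' {x} = ∅ := by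
    ext y
    exact ⟨fun h => hx ⟨y, h⟩, fun h => h.elim⟩
  refine (Function.locallyFinsupp.map_apply _ _ _ _).trans ?_
  rw [hpre, finsum_mem_empty]

theorem pushforward_id (c : AlgebraicCycle X ℤ) : pushforward (𝟙 X) c = c :=
  AlgebraicCycle.map_id _ c

/-- A dense open subset of a Noetherian scheme contains all maximal points. -/
theorem mem_of_dense_of_maximal [NoetherianSpace Z] {U : Set Z} (hU : IsOpen U) (hd : Dense U)
    {z : Z} (hz : ∀ y : Z, y ⤳ z → y = z) : z ∈ U := by
  -- A component of a Noetherian space contains a nonempty open set, which `U` meets in some `y`.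
  -- Then `z` specializes to `y`, and an open set is stable under generization.
  obtain ⟨o, ho, hne, hle⟩ := NoetherianSpace.exists_isOpen_nonempty_subset_irreducibleComponent
    (closure {z}) ((mem_irreducibleComponents_closure_iff z).2 hz)
  obtain ⟨y, hyo, hyU⟩ := hd.inter_open_nonempty o ho hne
  exact (specializes_iff_mem_closure.2 (hle hyo)).mem_open hU hyU

end Cycles

/-! ### The prime ideal of the closed orbit of a chart. -/

section Monomial

variable {N : Type u} [AddCommGroup N]

theorem charReal_neg (m : CharLattice N) : charReal (-m) = -charReal m :=
  eq_neg_of_add_eq_zero_left (by rw [← charReal_add, neg_add_cancel, charReal_zero])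

/-- The characters which vanish on the cone `σ`. -/
def IsPerp (σ : PointedCone ℝ (NReal N)) (m : CharLattice N) : Prop :=
  ∀ u ∈ σ, charReal m u = 0

/-- Both terms are nonnegative on `σ`, so their sum vanishes only if each does. This makes
`orbitRetraction` multiplicative. -/
theorem isPerp_add_iff {σ : PointedCone ℝ (NReal N)} {m m' : CharLattice N}
    (hm : m ∈ dualMonoid σ) (hm' : m' ∈ dualMonoid σ) :
    IsPerp σ (m + m') ↔ IsPerp σ m ∧ IsPerp σ m' := by
  simp only [IsPerp, charReal_add, LinearMap.add_apply]
  constructor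
  · intro h
    exact ⟨fun u hu => by linarith [h u hu, hm u hu, hm' u hu],
      fun u hu => by linarith [h u hu, hm u hu, hm' u hu]⟩
  · rintro ⟨h, h'⟩ u hu
    rw [h u hu, h' u hu, add_zero]

theorem isPerp_iff_cutFace_eq {σ : PointedCone ℝ (NReal N)} {m : CharLattice N} :
    IsPerp σ m ↔ cutFace σ m = σ := by
  constructor
  · intro h
    ext u
    rw [mem_cutFace]
    exact ⟨fun hu => hu.1, fun hu => ⟨hu, h u hu⟩⟩
  · intro h u hu
    rw [← h, mem_cutFace] at hu
    exact hu.2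

variable (K : Type u) [Field K]

open Classical in
/-- The map `K[σ^∨ ∩ M] → K[M]` which kills the characters not in `σ^⊥`; its image is the coordinate
ring `K[σ^⊥ ∩ M]` of the closed orbit of the chart. -/
noncomputable def orbitRetraction (σ : PointedCone ℝ (NReal N)) :
    ChartRing K σ →ₐ[K] AddMonoidAlgebra K (CharLattice N) :=
  AddMonoidAlgebra.lift K _ _
    { toFun := fun m => if IsPerp σ (m.toAdd : CharLattice N) then
        AddMonoidAlgebra.single (m.toAdd : CharLattice N) 1 else 0
      map_one' := if_pos fun u _ => by
        show charReal (0 : CharLattice N) u = 0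
        rw [charReal_zero, LinearMap.zero_apply]
      map_mul' := fun m m' => by
        have h := isPerp_add_iff m.toAdd.2 m'.toAdd.2
        rw [toAdd_mul, AddSubmonoid.coe_add]
        by_cases h1 : IsPerp σ (m.toAdd : CharLattice N)
        · by_cases h2 : IsPerp σ (m'.toAdd : CharLattice N)
          · rw [if_pos h1, if_pos h2, if_pos (h.2 ⟨h1, h2⟩), AddMonoidAlgebra.single_mul_single,
              mul_one]
          · rw [if_neg h2, if_neg fun h3 => h2 (h.1 h3).2, mul_zero]
        · rw [if_neg h1, if_neg fun h3 => h1 (h.1 h3).1, zero_mul] }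

open Classical in
theorem orbitRetraction_single (σ : PointedCone ℝ (NReal N)) (m : dualMonoid σ) (c : K) :
    orbitRetraction K σ (AddMonoidAlgebra.single m c) =
      if IsPerp σ (m : CharLattice N) then AddMonoidAlgebra.single (m : CharLattice N) c else 0 := by
  rw [orbitRetraction, AddMonoidAlgebra.lift_single]
  show c • (if IsPerp σ (m : CharLattice N) then
    AddMonoidAlgebra.single (m : CharLattice N) 1 else 0) = _
  split_ifs <;> simp

theorem coeff_orbitRetraction (σ : PointedCone ℝ (NReal N)) (f : ChartRing K σ) (m : dualMonoid σ)
    (hm : IsPerp σ (m : CharLattice N)) :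
    (orbitRetraction K σ f).coeff (m : CharLattice N) = f.coeff m := by
  classical
  induction f using AddMonoidAlgebra.induction_linear with
  | zero => simp
  | add f g hf hg =>
    rw [map_add, AddMonoidAlgebra.coeff_add, AddMonoidAlgebra.coeff_add, Finsupp.add_apply,
      Finsupp.add_apply, hf, hg]
  | single m' c =>
    rw [orbitRetraction_single]
    split_ifs with h
    · rw [AddMonoidAlgebra.coeff_single, AddMonoidAlgebra.coeff_single, Finsupp.single_apply,
        Finsupp.single_apply]
      simp only [Subtype.ext_iff]
    · rw [AddMonoidAlgebra.coeff_single, Finsupp.single_apply, if_neg]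
      · rfl
      · rintro rfl
        exact h hm

theorem chartToTorus_single (σ : PointedCone ℝ (NReal N)) (m : dualMonoid σ) (c : K) :
    chartToTorus K σ (AddMonoidAlgebra.single m c) =
      AddMonoidAlgebra.single (m : CharLattice N) c := by
  simp [chartToTorus]

theorem coeff_chartToTorus (σ : PointedCone ℝ (NReal N)) (f : ChartRing K σ) (m : dualMonoid σ) :
    (chartToTorus K σ f).coeff (m : CharLattice N) = f.coeff m := by
  classical
  induction f using AddMonoidAlgebra.induction_linear with
  | zero => simp
  | add f g hf hg =>
    rw [map_add, AddMonoidAlgebra.coeff_add, AddMonoidAlgebra.coeff_add, Finsupp.add_apply,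
      Finsupp.add_apply, hf, hg]
  | single m' c =>
    rw [chartToTorus_single, AddMonoidAlgebra.coeff_single, AddMonoidAlgebra.coeff_single,
      Finsupp.single_apply, Finsupp.single_apply]
    simp only [Subtype.ext_iff]

theorem exists_chartToTorus_eq (σ : PointedCone ℝ (NReal N))
    (f : AddMonoidAlgebra K (CharLattice N)) (hf : ∀ m, f.coeff m ≠ 0 → m ∈ dualMonoid σ) :
    ∃ g, chartToTorus K σ g = f := by
  rw [← f.sum_coeff_single]
  exact (chartToTorus K σ).range.sum_mem fun m hm =>
    ⟨AddMonoidAlgebra.single ⟨m, hf m (Finsupp.mem_support_iff.1 hm)⟩ (f.coeff m),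
      chartToTorus_single K σ _ _⟩

/-- The ideal of the closed orbit of the chart `U_σ`. -/
noncomputable def orbitIdeal (σ : PointedCone ℝ (NReal N)) : Ideal (ChartRing K σ) :=
  RingHom.ker (orbitRetraction K σ)

variable {K}

theorem single_mem_orbitIdeal {σ : PointedCone ℝ (NReal N)} {m : dualMonoid σ} {c : K}
    (h : ¬ IsPerp σ (m : CharLattice N)) : AddMonoidAlgebra.single m c ∈ orbitIdeal K σ := by
  classical
  rw [orbitIdeal, RingHom.mem_ker, orbitRetraction_single, if_neg h]

theorem coeff_eq_zero_of_mem_orbitIdeal {σ : PointedCone ℝ (NReal N)} {f : ChartRing K σ}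
    (hf : f ∈ orbitIdeal K σ) {m : dualMonoid σ} (hm : IsPerp σ (m : CharLattice N)) :
    f.coeff m = 0 := by
  rw [← coeff_orbitRetraction K σ f m hm, RingHom.mem_ker.1 hf]
  rfl

theorem single_mem_orbitIdeal_iff {σ : PointedCone ℝ (NReal N)} {m : dualMonoid σ} :
    AddMonoidAlgebra.single m (1 : K) ∈ orbitIdeal K σ ↔ ¬ IsPerp σ (m : CharLattice N) := by
  refine ⟨fun h hm => one_ne_zero (α := K) ?_, single_mem_orbitIdeal⟩
  rw [← coeff_eq_zero_of_mem_orbitIdeal h hm]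
  simp

/-- A member of the orbit ideal has no coefficient in `σ^⊥`, so the ideal is generated by the
monomials it contains. -/
theorem orbitIdeal_le_iff {σ : PointedCone ℝ (NReal N)} {I : Ideal (ChartRing K σ)} :
    orbitIdeal K σ ≤ I ↔ ∀ m : dualMonoid σ, ¬ IsPerp σ (m : CharLattice N) →
      AddMonoidAlgebra.single m (1 : K) ∈ I := by
  refine ⟨fun h m hm => h (single_mem_orbitIdeal hm), fun h f hf => ?_⟩
  rw [← f.sum_coeff_single]
  refine I.sum_mem fun m hm => ?_
  have hs : AddMonoidAlgebra.single m (f.coeff m) =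
      AddMonoidAlgebra.single 0 (f.coeff m) * AddMonoidAlgebra.single m (1 : K) := by
    rw [AddMonoidAlgebra.single_mul_single, zero_add, mul_one]
  show AddMonoidAlgebra.single m (f.coeff m) ∈ I
  rw [hs]
  refine I.mul_mem_left _ (h m fun hp => ?_)
  exact Finsupp.mem_support_iff.1 hm (coeff_eq_zero_of_mem_orbitIdeal hf hp)

variable [Module.Free ℤ N] [Module.Finite ℤ N]

/-- The quotient embeds in the domain `K[M]`. -/
instance isPrime_orbitIdeal (σ : PointedCone ℝ (NReal N)) : (orbitIdeal K σ).IsPrime :=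
  RingHom.ker_isPrime _

end Monomial

/-! ### Rays: the generator and the local equation of `V(τ)`. -/

section Ray

variable {N : Type u} [AddCommGroup N] [Module.Free ℤ N] [Module.Finite ℤ N]

/-- A nonzero lattice vector that is not a proper multiple takes the value one on some character. -/
theorem exists_apply_eq_one {v : N} (hv : ∀ (d : ℕ) (w : N), v = d • w → d = 1) :
    ∃ m : CharLattice N, m v = 1 := by
  -- The values `m v` form an ideal `(d)` of `ℤ`. All coordinates of `v` are multiples of `d`, so
  -- `v` is `d` times a lattice vector and `d = ±1`.
  obtain ⟨d, hd⟩ := (IsPrincipalIdealRing.principal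
    (LinearMap.range (Module.Dual.eval ℤ N v))).principal
  have hdvd : ∀ m : CharLattice N, d ∣ m v := fun m => by
    rw [← Ideal.mem_span_singleton]
    show m v ∈ Submodule.span ℤ {d}
    rw [← hd]
    exact ⟨m, rfl⟩
  let b := Module.Free.chooseBasis ℤ N
  choose c hc using fun i => hdvd (b.coord i)
  have hvw : v = d • ∑ i, c i • b i := by
    rw [Finset.smul_sum]
    conv_lhs => rw [← b.sum_repr v]
    refine Finset.sum_congr rfl fun i _ => ?_
    rw [smul_smul, ← hc i]
    rfl
  have h1 : d.natAbs = 1 := by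
    rcases Int.natAbs_eq d with h | h
    · exact hv _ (∑ i, c i • b i) (by rw [← natCast_zsmul, ← h, ← hvw])
    · refine hv _ (-∑ i, c i • b i) ?_
      rw [← natCast_zsmul, smul_neg, ← neg_smul, ← h, ← hvw]
  have hmem : (1 : ℤ) ∈ LinearMap.range (Module.Dual.eval ℤ N v) := by
    rw [hd]
    show 1 ∈ Ideal.span {d}
    rw [Ideal.mem_span_singleton]
    exact Int.natAbs_dvd.1 (by simp [h1])
  exact hmem

variable {Δ : Fan N}

theorem Fan.Ray.generator_ne_zero (τ : Δ.Ray) : τ.generator ≠ 0 :=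
  τ.exists_generator.choose_spec.1

theorem Fan.Ray.latticeMap_mem_iff (τ : Δ.Ray) (w : N) :
    latticeMap w ∈ τ.1.1 ↔ ∃ k : ℕ, w = k • τ.generator :=
  τ.exists_generator.choose_spec.2 w

theorem Fan.Ray.latticeMap_generator_mem (τ : Δ.Ray) : latticeMap τ.generator ∈ τ.1.1 :=
  (τ.latticeMap_mem_iff _).2 ⟨1, (one_smul _ _).symm⟩

theorem Fan.Ray.eq_hull (τ : Δ.Ray) :
    τ.1.1 = PointedCone.hull ℝ (latticeMap '' {τ.generator}) := by
  refine le_antisymm ?_ ?_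
  · obtain ⟨s, hs⟩ := Δ.rational _ τ.1.2
    have hmem : ∀ v ∈ s, latticeMap v ∈ τ.1.1 := fun v hv => by
      rw [hs]
      exact PointedCone.subset_hull (Set.mem_image_of_mem _ hv)
    rw [hs]
    refine Submodule.span_le.2 ?_
    rintro _ ⟨v, hv, rfl⟩
    obtain ⟨k, hk⟩ := (τ.latticeMap_mem_iff v).1 (hmem v hv)
    rw [hk, map_nsmul]
    have hg : latticeMap τ.generator ∈ PointedCone.hull ℝ (latticeMap '' {τ.generator}) :=
      PointedCone.subset_hull (Set.mem_image_of_mem _ (Set.mem_singleton _))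
    exact nsmul_mem hg k
  · refine Submodule.span_le.2 ?_
    rintro _ ⟨v, rfl, rfl⟩
    exact τ.latticeMap_generator_mem

theorem Fan.Ray.mem_dualMonoid_iff (τ : Δ.Ray) (m : CharLattice N) :
    m ∈ dualMonoid τ.1.1 ↔ 0 ≤ m τ.generator := by
  rw [τ.eq_hull, mem_dualMonoid_hull]
  simp

theorem Fan.Ray.isPerp_iff (τ : Δ.Ray) (m : CharLattice N) :
    IsPerp τ.1.1 m ↔ m τ.generator = 0 := by
  constructor
  · intro h
    have := h _ τ.latticeMap_generator_mem
    rw [charReal_latticeMap] at this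
    exact_mod_cast this
  · intro h u hu
    have h1 := (τ.mem_dualMonoid_iff m).2 h.ge u hu
    have h2 := (τ.mem_dualMonoid_iff (-m)).2 (by simp [h]) u hu
    rw [charReal_neg, LinearMap.neg_apply] at h2
    linarith

theorem Fan.Ray.exists_apply_generator_eq_one (τ : Δ.Ray) :
    ∃ m : CharLattice N, m τ.generator = 1 := by
  refine exists_apply_eq_one fun d w hw => ?_
  have hd : d ≠ 0 := by
    rintro rfl
    exact τ.generator_ne_zero (by rw [hw, zero_smul])
  -- If `v = d • w` for the generator `v`, then `w` lies on the ray too, so `w = k • v` and `d * k =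
  -- 1`.
  have hmem : latticeMap w ∈ τ.1.1 := by
    have h : latticeMap w = (d : ℝ)⁻¹ • latticeMap τ.generator := by
      conv_rhs => rw [hw, map_nsmul, ← Nat.cast_smul_eq_nsmul ℝ, smul_smul,
        inv_mul_cancel₀ (Nat.cast_ne_zero.2 hd), one_smul]
    rw [h]
    exact PointedCone.smul_mem _ (by positivity) τ.latticeMap_generator_mem
  obtain ⟨k, hk⟩ := (τ.latticeMap_mem_iff w).1 hmem
  obtain ⟨m, hm⟩ : ∃ m : CharLattice N, m τ.generator ≠ 0 := by
    by_contra! hcon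
    exact τ.generator_ne_zero ((Module.forall_dual_apply_eq_zero_iff ℤ _).1 hcon)
  have h1 : m τ.generator = (d * k : ℤ) * m τ.generator := by
    conv_lhs => rw [hw, hk, smul_smul, map_nsmul, nsmul_eq_mul]
    push_cast
    rfl
  have h2 : (d * k : ℤ) = 1 := by
    have : ((d * k : ℤ) - 1) * m τ.generator = 0 := by linarith
    rcases mul_eq_zero.1 this with h | h
    · linarith
    · exact absurd h hm
  exact Nat.eq_one_of_mul_eq_one_right (m := d) (n := k) (by exact_mod_cast h2)

variable (K : Type u) [Field K]

/-- A character of the chart outside `τ^⊥` is at least one on the generator, so subtracting `m`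
keeps it in the dual monoid: `χ^m` divides it. -/
theorem Fan.Ray.orbitIdeal_eq_span (τ : Δ.Ray) {m : dualMonoid τ.1.1}
    (hm : (m : CharLattice N) τ.generator = 1) :
    orbitIdeal K τ.1.1 = Ideal.span {AddMonoidAlgebra.single m (1 : K)} := by
  refine le_antisymm (orbitIdeal_le_iff.2 fun p hp => ?_) ?_
  · rw [τ.isPerp_iff] at hp
    have h0 := (τ.mem_dualMonoid_iff _).1 p.2
    have hq : (p : CharLattice N) - (m : CharLattice N) ∈ dualMonoid τ.1.1 := by
      rw [τ.mem_dualMonoid_iff, LinearMap.sub_apply, hm]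
      omega
    rw [Ideal.mem_span_singleton]
    refine ⟨AddMonoidAlgebra.single ⟨_, hq⟩ 1, ?_⟩
    rw [AddMonoidAlgebra.single_mul_single, mul_one]
    congr 1
    ext
    simp
  · rw [Ideal.span_singleton_le_iff_mem, single_mem_orbitIdeal_iff, τ.isPerp_iff, hm]
    exact one_ne_zero

/-- The ideal is generated by one nonzero nonunit, so Krull's principal ideal theorem applies. -/
theorem Fan.Ray.height_orbitIdeal (τ : Δ.Ray) : (orbitIdeal K τ.1.1).height = 1 := by
  obtain ⟨m, hm⟩ := τ.exists_apply_generator_eq_one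
  have hm' : m ∈ dualMonoid τ.1.1 := (τ.mem_dualMonoid_iff m).2 (by omega)
  have := isNoetherianRing_chartRing K (Δ.rational _ τ.1.2)
  rw [τ.orbitIdeal_eq_span K (m := ⟨m, hm'⟩) hm]
  refine Ideal.height_span_singleton_eq_one_of_mem_nonZeroDivisors ?_ ?_
  · exact mem_nonZeroDivisors_of_ne_zero (by simp)
  · rw [← Ideal.span_singleton_eq_top, ← τ.orbitIdeal_eq_span K (m := ⟨m, hm'⟩) hm]
    exact (isPrime_orbitIdeal _).ne_top

/-- `χ^m` generates the maximal ideal, and the residue field has length one. -/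
theorem Fan.Ray.ord_single (τ : Δ.Ray) {m : dualMonoid τ.1.1}
    (hm : (m : CharLattice N) τ.generator = 1) :
    Ring.ord (Localization.AtPrime (orbitIdeal K τ.1.1))
      (algebraMap _ _ (AddMonoidAlgebra.single m (1 : K))) = 1 := by
  rw [Ring.ord, Module.length_eq_one_iff]
  have h : Ideal.span {algebraMap _ (Localization.AtPrime (orbitIdeal K τ.1.1))
      (AddMonoidAlgebra.single m (1 : K))} =
      IsLocalRing.maximalIdeal (Localization.AtPrime (orbitIdeal K τ.1.1)) := by
    rw [← Localization.AtPrime.map_eq_maximalIdeal, ← Set.image_singleton, ← Ideal.map_span]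
    exact congrArg _ (τ.orbitIdeal_eq_span K hm).symm
  rw [h]
  exact isSimpleModule_iff_isCoatom.2 (IsLocalRing.maximalIdeal.isMaximal _).out

end Ray

/-! ### Cones without proper nonzero faces are rays. -/

section Faces

variable {N : Type u} [AddCommGroup N] [Module.Free ℤ N] [Module.Finite ℤ N] {Δ : Fan N}

omit [Module.Finite ℤ N] in
/-- A cone of a fan of dimension at least two has a proper nonzero face. -/
theorem Fan.Cone.finrank_eq_one (τ : Δ.Cone) (hτ : τ.1 ≠ ⊥)
    (hface : ∀ m ∈ dualMonoid τ.1, cutFace τ.1 m ≠ ⊥ → cutFace τ.1 m = τ.1) :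
    Module.finrank ℝ (Submodule.span ℝ (τ.1 : Set (NReal N))) = 1 := by
  classical
  -- `p` cuts out the zero face, so it is positive on the nonzero generators.
  obtain ⟨p, hp, ep⟩ := Δ.exists_cutFace_of_le (Δ.zeroCone_le τ)
  change ⊥ = cutFace τ.1 p at ep
  obtain ⟨s, hs⟩ := Δ.rational _ τ.2
  have hmem : ∀ v ∈ s, latticeMap v ∈ τ.1 := fun v hv => by
    rw [hs]
    exact PointedCone.subset_hull (Set.mem_image_of_mem _ hv)
  have hzero : ∀ v ∈ s, p v = 0 → latticeMap v = 0 := fun v hv h => by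
    have h1 : latticeMap v ∈ cutFace τ.1 p :=
      mem_cutFace.2 ⟨hmem v hv, by rw [charReal_latticeMap, h, Int.cast_zero]⟩
    rw [← ep] at h1
    exact (Submodule.mem_bot _).1 h1
  have hnonneg : ∀ v ∈ s, 0 ≤ p v := by
    have := hp
    rw [hs, mem_dualMonoid_hull] at this
    exact fun v hv => this v hv
  obtain ⟨v₀, hv₀, hne⟩ : ∃ v ∈ s, latticeMap v ≠ 0 := by
    by_contra! hcon
    refine hτ ?_
    rw [hs, Submodule.span_eq_bot]
    rintro _ ⟨v, hv, rfl⟩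
    exact hcon v hv
  have hpos : ∀ v ∈ s, latticeMap v ≠ 0 → 0 < p v := fun v hv h =>
    lt_of_le_of_ne (hnonneg v hv) fun h' => h (hzero v hv h'.symm)
  have hprop : ∀ (q : CharLattice N), ∀ v ∈ s, q v * p v₀ = q v₀ * p v := by
    -- Let `w` be a generator of least slope `q / p`; the filter avoids zero denominators. Then `p w
    -- • q - q w • p` is nonnegative on the cone and zero at `w`, so it cuts out a nonzero face,
    -- hence the whole cone. Thus `q` is proportional to `p` on the generators.
    intro q
    obtain ⟨w, hw, hmin⟩ := Finset.exists_min_image (s.filter fun v => 0 < p v)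
      (fun v => (q v : ℚ) / p v) ⟨v₀, Finset.mem_filter.2 ⟨hv₀, hpos v₀ hv₀ hne⟩⟩
    rw [Finset.mem_filter] at hw
    set m : CharLattice N := p w • q - q w • p with hm
    have hmv : ∀ v, m v = p w * q v - q w * p v := fun v => by simp [hm]
    have hmd : m ∈ dualMonoid τ.1 := by
      rw [hs, mem_dualMonoid_hull]
      intro v hv
      rw [hmv]
      rcases (hnonneg v hv).eq_or_lt with h | h
      · have hz := hzero v hv h.symm
        have : (q v : ℝ) = 0 := by rw [← charReal_latticeMap, hz, map_zero]
        have : q v = 0 := by exact_mod_cast this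
        simp [this, ← h]
      · have h1 := hmin v (Finset.mem_filter.2 ⟨hv, h⟩)
        have h2 : (0 : ℚ) < p w := by exact_mod_cast hw.2
        have h3 : (0 : ℚ) < p v := by exact_mod_cast h
        rw [div_le_div_iff₀ h2 h3] at h1
        have : q w * p v ≤ q v * p w := by exact_mod_cast h1
        linarith
    have hne' : cutFace τ.1 m ≠ ⊥ := by
      intro h
      have hwmem : latticeMap w ∈ cutFace τ.1 m := by
        refine mem_cutFace.2 ⟨hmem w hw.1, ?_⟩
        rw [charReal_latticeMap, hmv, mul_comm, sub_self, Int.cast_zero]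
      rw [h, Submodule.mem_bot] at hwmem
      have := charReal_latticeMap p w
      rw [hwmem, map_zero] at this
      exact hw.2.ne (by exact_mod_cast this)
    have hperp := isPerp_iff_cutFace_eq.2 (hface m hmd hne')
    have hall : ∀ v ∈ s, p w * q v = q w * p v := fun v hv => by
      have := hperp _ (hmem v hv)
      rw [charReal_latticeMap, hmv] at this
      have : p w * q v - q w * p v = 0 := by exact_mod_cast this
      linarith
    intro v hv
    have h1 := hall v hv
    have h2 := hall v₀ hv₀
    refine mul_left_cancel₀ hw.2.ne' ?_
    calc p w * (q v * p v₀) = (p w * q v) * p v₀ := by ring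
      _ = (p w * q v₀) * p v := by rw [h1, h2]; ring
      _ = p w * (q v₀ * p v) := by ring
  have hp₀ : (p v₀ : ℝ) ≠ 0 := by exact_mod_cast (hpos v₀ hv₀ hne).ne'
  have hv : ∀ v ∈ s, latticeMap v = ((p v₀ : ℝ)⁻¹ * p v) • latticeMap v₀ := by
    intro v hv
    -- Characters separate lattice vectors, so `hprop` makes every generator proportional to `v₀`.
    have h0 : p v₀ • v - p v • v₀ = 0 :=
      (Module.forall_dual_apply_eq_zero_iff ℤ _).1 fun q => by
        rw [map_sub, map_smul, map_smul, smul_eq_mul, smul_eq_mul]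
        linarith [hprop q v hv]
    have h1 : (p v₀ : ℝ) • latticeMap v = (p v : ℝ) • latticeMap v₀ := by
      rw [Int.cast_smul_eq_zsmul, Int.cast_smul_eq_zsmul, ← map_zsmul, ← map_zsmul,
        sub_eq_zero.1 h0]
    rw [mul_smul, ← h1, smul_smul, inv_mul_cancel₀ hp₀, one_smul]
  have hspan : Submodule.span ℝ (τ.1 : Set (NReal N)) = Submodule.span ℝ {latticeMap v₀} := by
    refine le_antisymm (Submodule.span_le.2 ?_) (Submodule.span_mono (by simpa using hmem v₀ hv₀))
    have hle : τ.1 ≤ PointedCone.ofSubmodule (Submodule.span ℝ {latticeMap v₀}) := by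
      conv_lhs => rw [hs]
      refine Submodule.span_le.2 ?_
      rintro _ ⟨v, hvs, rfl⟩
      show latticeMap v ∈ Submodule.span ℝ {latticeMap v₀}
      rw [hv v hvs]
      exact Submodule.smul_mem _ _ (Submodule.mem_span_singleton_self _)
    exact hle
  rw [hspan, finrank_span_singleton hne]

end Faces

/-! ### Generic points of orbits and codimension one outside the torus. -/

section OrbitPoints

variable (K : Type u) [Field K] {N : Type u} [AddCommGroup N] [Module.Free ℤ N]
  [Module.Finite ℤ N] (Δ : Fan N)

/-- The generic point of the closed orbit in its chart. -/
noncomputable def orbitPoint (τ : Δ.Cone) : Spec (CommRingCat.of (ChartRing K τ.1)) :=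
  (⟨orbitIdeal K τ.1, inferInstance⟩ : PrimeSpectrum (ChartRing K τ.1))

/-- The generic point of the orbit `O(τ)`. -/
noncomputable def orbitGenericPoint (τ : Δ.Cone) : toricVariety K Δ :=
  chartι K Δ τ (orbitPoint K Δ τ)

/-- In its chart the orbit is the zero locus of the prime `orbitIdeal`, that is, the closure of one
point. -/
theorem isGenericPoint_orbitClosure (τ : Δ.Cone) :
    IsGenericPoint (orbitGenericPoint K Δ τ) (orbitClosure K Δ τ) := by
  have h : {x : PrimeSpectrum (ChartRing K τ.1) | ∀ m : dualMonoid τ.1,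
      (∃ u ∈ τ.1, charReal (m : CharLattice N) u ≠ 0) →
        AddMonoidAlgebra.single m (1 : K) ∈ x.asIdeal} =
      closure {(⟨orbitIdeal K τ.1, inferInstance⟩ : PrimeSpectrum (ChartRing K τ.1))} := by
    ext x
    rw [PrimeSpectrum.closure_singleton, PrimeSpectrum.mem_zeroLocus]
    refine Iff.trans ?_ orbitIdeal_le_iff.symm
    simp only [IsPerp, not_forall, exists_prop]
    rfl
  have hgen := (chartι K Δ τ).continuous
  refine Eq.trans ?_ ((closure_image_closure hgen).symm.trans
    (congrArg (fun S => closure (chartι K Δ τ '' S)) h.symm))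
  exact congrArg closure
    (Set.image_singleton (f := chartι K Δ τ) (a := orbitPoint K Δ τ)).symm

variable {K Δ}

/-- A point common to two charts comes from a cone `ρ` below both, cut out of `τ` by some `m`. The
monomial `χ^m` is nonzero at the generic point of the orbit, so `m ∈ τ^⊥` and `ρ = τ`. -/
theorem le_of_orbitGenericPoint_mem_range {τ σ : Δ.Cone}
    (h : orbitGenericPoint K Δ τ ∈ Set.range (chartι K Δ σ)) : τ ≤ σ := by
  obtain ⟨y, hy⟩ := h
  obtain ⟨ρ, hρτ, hρσ, z, hz, -⟩ :=
    (Scheme.IsLocallyDirected.ι_eq_ι_iff (chartDiagram K Δ)).1 hy.symm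
  obtain ⟨m, hm, e⟩ := Δ.exists_cutFace_of_le (leOfHom hρτ)
  have hmem : orbitPoint K Δ τ ∈ Set.range ((chartDiagram K Δ).map hρτ) := ⟨z, hz⟩
  rw [range_chartDiagram_map K Δ hρτ ⟨m, hm⟩ e] at hmem
  have hperp : IsPerp τ.1 m := by
    by_contra hcon
    exact hmem (single_mem_orbitIdeal_iff.2 hcon)
  rw [isPerp_iff_cutFace_eq, ← e] at hperp
  have : ρ = τ := Subtype.ext hperp
  exact this ▸ leOfHom hρσ

theorem orbitGenericPoint_injective : Function.Injective (orbitGenericPoint K Δ) := by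
  intro τ σ h
  exact le_antisymm (le_of_orbitGenericPoint_mem_range ⟨_, h.symm⟩)
    (le_of_orbitGenericPoint_mem_range ⟨_, h⟩)

omit [Module.Free ℤ N] [Module.Finite ℤ N] in
theorem range_chartι_zeroCone :
    Set.range (chartι K Δ Δ.zeroCone) = Set.range (torusι K Δ) := by
  have : IsIso (CommRingCat.ofHom (chartToTorus K Δ.zeroCone.1).toRingHom) :=
    (ConcreteCategory.isIso_iff_bijective _).2 (chartToTorus_bot_bijective K)
  ext x
  constructor
  · rintro ⟨y, rfl⟩
    obtain ⟨z, rfl⟩ := (Spec.map (CommRingCat.ofHom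
      (chartToTorus K Δ.zeroCone.1).toRingHom)).surjective y
    exact ⟨z, rfl⟩
  · rintro ⟨z, rfl⟩
    exact ⟨_, rfl⟩

theorem Fan.Ray.orbitGenericPoint_notMem_range_torusι (τ : Δ.Ray) :
    orbitGenericPoint K Δ τ.1 ∉ Set.range (torusι K Δ) := by
  rw [← range_chartι_zeroCone]
  intro h
  have hle : τ.1.1 ≤ ⊥ := le_of_orbitGenericPoint_mem_range h
  have hmem := hle τ.latticeMap_generator_mem
  obtain ⟨m, hm⟩ := τ.exists_apply_generator_eq_one
  have h0 := mem_dualMonoid_bot (-m) _ hmem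
  rw [charReal_latticeMap, LinearMap.neg_apply, hm] at h0
  norm_num at h0

theorem Fan.Ray.coheight_orbitGenericPoint (τ : Δ.Ray) :
    Order.coheight (orbitGenericPoint K Δ τ.1) = 1 := by
  rw [orbitGenericPoint, coheight_chart]
  exact τ.height_orbitIdeal K

/-- The points of codimension one outside the torus are the generic points of the divisors
`V(τ)`. -/
theorem exists_ray_of_coheight_eq_one {x : toricVariety K Δ} (hx : Order.coheight x = 1)
    (hxT : x ∉ Set.range (torusι K Δ)) : ∃ τ : Δ.Ray, x = orbitGenericPoint K Δ τ.1 := by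
  have hne : {σ : Δ.Cone | x ∈ Set.range (chartι K Δ σ)}.Nonempty := by
    obtain ⟨σ, y, hy⟩ := Scheme.IsLocallyDirected.ι_jointly_surjective (chartDiagram K Δ) x
    exact ⟨σ, y, hy⟩
  -- By minimality of `τ`, every monomial outside `τ^⊥` vanishes at `x`: otherwise `x` would lie in
  -- the chart of a proper face.
  obtain ⟨τ, ⟨p, rfl⟩, hmin⟩ := (Set.toFinite
    {σ : Δ.Cone | x ∈ Set.range (chartι K Δ σ)}).exists_minimal hne
  have hmono : ∀ m : dualMonoid τ.1, ¬ IsPerp τ.1 (m : CharLattice N) →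
      AddMonoidAlgebra.single m (1 : K) ∈ p.asIdeal := by
    intro m hm
    by_contra hcon
    let ρ : Δ.Cone := ⟨cutFace τ.1 m, Δ.face_mem _ τ.2 _ m.2⟩
    have hρ : ρ ≤ τ := show cutFace τ.1 m ≤ τ.1 from inf_le_left
    have hp : p ∈ Set.range ((chartDiagram K Δ).map (homOfLE hρ)) := by
      rw [range_chartDiagram_map K Δ (homOfLE hρ) m rfl]
      exact hcon
    obtain ⟨z, rfl⟩ := hp
    have hz : chartι K Δ τ ((chartDiagram K Δ).map (homOfLE hρ) z) ∈
        Set.range (chartι K Δ ρ) := ⟨z, by rw [← chartι_comp K Δ hρ]; rfl⟩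
    have := hmin hz hρ
    exact hm (isPerp_iff_cutFace_eq.2 (le_antisymm hρ this))
  have hle : orbitIdeal K τ.1 ≤ p.asIdeal := orbitIdeal_le_iff.2 hmono
  have hτ : τ.1 ≠ ⊥ := by
    intro h
    have hτ0 : τ = Δ.zeroCone := Subtype.ext h
    subst hτ0
    rw [← range_chartι_zeroCone] at hxT
    exact hxT ⟨p, rfl⟩
  have hface : ∀ ρ ≤ τ, ρ ≠ τ → ∃ m : dualMonoid τ.1, IsPerp ρ.1 (m : CharLattice N) ∧
      ¬ IsPerp τ.1 (m : CharLattice N) := by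
    intro ρ hρ hne
    obtain ⟨m, hm, e⟩ := Δ.exists_cutFace_of_le hρ
    refine ⟨⟨m, hm⟩, ?_, ?_⟩
    · rw [e]
      exact fun u hu => (mem_cutFace.1 hu).2
    · rw [isPerp_iff_cutFace_eq, ← e]
      exact fun h => hne (Subtype.ext h)
  have hneBot : ∀ σ : Δ.Cone, σ.1 ≠ ⊥ → orbitIdeal K σ.1 ≠ ⊥ := by
    intro σ hσ h
    obtain ⟨m, hm, e⟩ := Δ.exists_cutFace_of_le (Δ.zeroCone_le σ)
    change ⊥ = cutFace σ.1 m at e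
    have hmem : AddMonoidAlgebra.single (⟨m, hm⟩ : dualMonoid σ.1) (1 : K) ∈ orbitIdeal K σ.1 := by
      rw [single_mem_orbitIdeal_iff, isPerp_iff_cutFace_eq]
      exact fun h => hσ (h.symm.trans e.symm)
    rw [h, Ideal.mem_bot] at hmem
    simp at hmem
  have hht : p.asIdeal.height = 1 := by rw [← coheight_chart (chartι K Δ τ), hx]
  have hpp : p.asIdeal.IsPrime := isPrime_asIdeal p
  have hbelow : ∀ I : Ideal (ChartRing K τ.1), I.IsPrime → I ≠ ⊥ → I ≤ p.asIdeal →
      I = p.asIdeal := fun I => eq_of_le_of_height_eq_one hht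
  have heq : orbitIdeal K τ.1 = p.asIdeal := hbelow _ inferInstance (hneBot τ hτ) hle
  refine ⟨⟨τ, Fan.Cone.finrank_eq_one τ hτ fun m hm hcut => ?_⟩, ?_⟩
  · by_contra hcon
    -- For a face `ρ` strictly between zero and `τ`, the ideal of `O(ρ)` contracts to a nonzero
    -- prime `I` below `p`, hence equal to `p`. But some character of the chart lies in `ρ^⊥` and
    -- not in `τ^⊥`.
    let ρ : Δ.Cone := ⟨cutFace τ.1 m, Δ.face_mem _ τ.2 _ hm⟩
    have hρ : ρ.1 ≤ τ.1 := inf_le_left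
    let I : Ideal (ChartRing K τ.1) := (orbitIdeal K ρ.1).comap (chartMap K hρ)
    have hmemI : ∀ m' : dualMonoid τ.1, AddMonoidAlgebra.single m' (1 : K) ∈ I ↔
        ¬ IsPerp ρ.1 (m' : CharLattice N) := by
      intro m'
      show chartMap K hρ (AddMonoidAlgebra.single m' (1 : K)) ∈ orbitIdeal K ρ.1 ↔ _
      rw [chartMap_single, single_mem_orbitIdeal_iff]
      rfl
    have hI0 : I ≠ ⊥ := by
      obtain ⟨m', hm', e⟩ := Δ.exists_cutFace_of_le (Δ.zeroCone_le τ)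
      change ⊥ = cutFace τ.1 m' at e
      intro h
      have hmem : AddMonoidAlgebra.single (⟨m', hm'⟩ : dualMonoid τ.1) (1 : K) ∈ I := by
        rw [hmemI]
        intro hperp
        refine hcut (le_bot_iff.1 ?_)
        rw [e]
        exact fun u hu => mem_cutFace.2 ⟨hρ hu, hperp u hu⟩
      rw [h, Ideal.mem_bot] at hmem
      simp at hmem
    -- Since `τ^⊥ ⊆ ρ^⊥`, an element of `I` has no coefficient in `τ^⊥`.
    have hIle : I ≤ orbitIdeal K τ.1 := by
      intro f hf
      rw [← f.sum_coeff_single]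
      refine (orbitIdeal K τ.1).sum_mem fun m' hm' => single_mem_orbitIdeal fun hperp => ?_
      have hρperp : IsPerp ρ.1 (m' : CharLattice N) := fun u hu => hperp u (hρ hu)
      have h0 := coeff_eq_zero_of_mem_orbitIdeal (K := K)
        (show chartMap K hρ f ∈ orbitIdeal K ρ.1 from hf)
        (m := AddSubmonoid.inclusion (dualMonoid_anti hρ) m') hρperp
      refine Finsupp.mem_support_iff.1 hm' ?_
      rw [← h0]
      exact (Finsupp.mapDomain_apply
        (AddSubmonoid.inclusion_injective (dualMonoid_anti hρ)) _ _).symm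
    have hIeq := hbelow I (Ideal.comap_isPrime _ _) hI0 (hIle.trans hle)
    obtain ⟨m', h1, h2⟩ := hface ρ hρ fun h => hcon (congrArg Subtype.val h)
    have h3 := single_mem_orbitIdeal_iff (K := K).2 h2
    rw [heq, ← hIeq, hmemI] at h3
    exact h3 h1
  · show chartι K Δ τ p = chartι K Δ τ (orbitPoint K Δ τ)
    congr 1
    exact PrimeSpectrum.ext heq.symm

end OrbitPoints

/-! ### The order of a Laurent polynomial along `V(τ)`. -/

section Divisor

variable {K : Type u} [Field K] {N : Type u} [AddCommGroup N] [Module.Free ℤ N]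
  [Module.Finite ℤ N] (Δ : Fan N)

instance nonempty_chartι_image (σ : Δ.Cone) : Nonempty (chartι K Δ σ ''ᵁ ⊤) :=
  ⟨⟨chartι K Δ σ (orbitPoint K Δ σ), _, trivial, rfl⟩⟩

/-- Extension of Laurent polynomials to rational functions, as a ring homomorphism. -/
noncomputable def rationalFunctionHom :
    AddMonoidAlgebra K (CharLattice N) →+* (toricVariety K Δ).functionField :=
  chartFunction (R := CommRingCat.of (AddMonoidAlgebra K (CharLattice N))) (torusι K Δ)

theorem rationalFunctionHom_apply (f : AddMonoidAlgebra K (CharLattice N)) :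
    rationalFunctionHom Δ f = rationalFunction Δ f := rfl

theorem rationalFunctionHom_chartToTorus (σ : Δ.Cone) (g : ChartRing K σ.1) :
    rationalFunctionHom Δ (chartToTorus K σ.1 g) =
      chartFunction (R := CommRingCat.of (ChartRing K σ.1)) (chartι K Δ σ) g :=
  chartFunction_comp (chartι K Δ σ) (torusι K Δ)
    (CommRingCat.ofHom (chartToTorus K σ.1).toRingHom) (torusι_eq K Δ σ).symm g

theorem rationalFunction_ne_zero {f : AddMonoidAlgebra K (CharLattice N)} (hf : f ≠ 0) :
    rationalFunctionHom Δ f ≠ 0 := by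
  rw [rationalFunctionHom_apply, rationalFunction,
    map_ne_zero_iff _ (Scheme.germToFunctionField_injective _ _)]
  intro h
  apply hf
  have h1 := congrArg ((torusι K Δ).appIso ⊤).hom h
  rw [Iso.inv_hom_id_apply, map_zero] at h1
  have h2 := congrArg (Scheme.ΓSpecIso (CommRingCat.of (AddMonoidAlgebra K (CharLattice N)))).hom h1
  rw [Iso.inv_hom_id_apply, map_zero] at h2
  exact h2

variable {Δ}

theorem Fan.Ray.ord_chart (τ : Δ.Ray) {g : ChartRing K τ.1.1} (hg : g ≠ 0) :
    Scheme.ord (rationalFunctionHom Δ (chartToTorus K τ.1.1 g)) (orbitGenericPoint K Δ τ.1) =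
      ((Ring.ord (Localization.AtPrime (orbitIdeal K τ.1.1)) (algebraMap _ _ g)).toNat : ℤ) := by
  have : IsDomain (CommRingCat.of (ChartRing K τ.1.1)) := isDomain_chartRing K τ.1.1
  rw [rationalFunctionHom_chartToTorus]
  exact ord_chartFunction (R := CommRingCat.of (ChartRing K τ.1.1)) (chartι K Δ τ.1)
    (orbitPoint K Δ τ.1) (τ.height_orbitIdeal K) hg

/-- The order of a character along `V(τ)`. -/
theorem Fan.Ray.ord_single_zsmul (τ : Δ.Ray) {m : CharLattice N} (hm : m τ.generator = 1) (k : ℤ) :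
    Scheme.ord (rationalFunctionHom Δ (AddMonoidAlgebra.single (k • m) (1 : K)))
      (orbitGenericPoint K Δ τ.1) = k := by
  have hne : ∀ p : CharLattice N,
      rationalFunctionHom Δ (AddMonoidAlgebra.single p (1 : K)) ≠ 0 := fun p =>
    rationalFunction_ne_zero Δ (by simp)
  -- The order is additive in the character, so the value at `m` decides all multiples, including
  -- negative ones that are not regular on the chart.
  let φ : CharLattice N →+ ℤ :=
    AddMonoidHom.mk' (fun p => Scheme.ord (rationalFunctionHom Δ (AddMonoidAlgebra.single p (1 : K)))
      (orbitGenericPoint K Δ τ.1)) fun p q => by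
        rw [← Scheme.ord_mul (hne p) (hne q), ← map_mul, AddMonoidAlgebra.single_mul_single, mul_one]
  have h1 : φ m = 1 := by
    have hm' : m ∈ dualMonoid τ.1.1 := (τ.mem_dualMonoid_iff m).2 (by omega)
    have := τ.ord_chart (K := K) (g := AddMonoidAlgebra.single ⟨m, hm'⟩ 1) (by simp)
    rw [chartToTorus_single, τ.ord_single K hm] at this
    exact this
  show φ (k • m) = k
  rw [map_zsmul, h1, smul_eq_mul, mul_one]

/-- The order of a Laurent polynomial along `V(τ)`. -/
theorem Fan.Ray.ord_rationalFunction (τ : Δ.Ray) {f : AddMonoidAlgebra K (CharLattice N)}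
    {m₀ : CharLattice N} (hm₀ : f.coeff m₀ ≠ 0)
    (hmin : ∀ m, f.coeff m ≠ 0 → m₀ τ.generator ≤ m τ.generator) :
    Scheme.ord (rationalFunction Δ f) (orbitGenericPoint K Δ τ.1) = m₀ τ.generator := by
  obtain ⟨t, ht⟩ := τ.exists_apply_generator_eq_one
  set k := m₀ τ.generator with hk
  have hcoeff : ∀ m, (AddMonoidAlgebra.single (-(k • t)) (1 : K) * f).coeff m =
      f.coeff (k • t + m) := fun m => by
    rw [AddMonoidAlgebra.coeff_single_mul_apply, neg_neg, one_mul]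
  -- Since `k` is the least value on the generator, dividing by `χ^{kt}` moves all exponents of `f`
  -- into the dual monoid.
  obtain ⟨g, hg⟩ := exists_chartToTorus_eq K τ.1.1 (AddMonoidAlgebra.single (-(k • t)) (1 : K) * f)
    fun m hm => by
      rw [hcoeff] at hm
      have := hmin _ hm
      rw [LinearMap.add_apply, LinearMap.smul_apply, ht] at this
      rw [τ.mem_dualMonoid_iff]
      simpa using this
  have hgf : AddMonoidAlgebra.single (k • t) (1 : K) * chartToTorus K τ.1.1 g = f := by
    rw [hg, ← mul_assoc, AddMonoidAlgebra.single_mul_single, add_neg_cancel, mul_one,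
      ← AddMonoidAlgebra.one_def, one_mul]
  have hperp : IsPerp τ.1.1 (m₀ - k • t) := by
    rw [τ.isPerp_iff, LinearMap.sub_apply, LinearMap.smul_apply, ht, ← hk]
    simp
  have hmem : m₀ - k • t ∈ dualMonoid τ.1.1 := fun u hu => (hperp u hu).ge
  -- The term of `f` at `m₀` becomes a nonzero term of `g` in `τ^⊥`, so `g` is a unit at the generic
  -- point of `V(τ)`.
  have hgP : g ∉ orbitIdeal K τ.1.1 := by
    intro h
    have h0 := coeff_eq_zero_of_mem_orbitIdeal h (m := ⟨_, hmem⟩) hperp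
    rw [← coeff_chartToTorus, hg, hcoeff, add_sub_cancel] at h0
    exact hm₀ h0
  have hg0 : g ≠ 0 := fun h => hgP (h ▸ zero_mem _)
  have hcg0 : chartToTorus K τ.1.1 g ≠ 0 := (map_ne_zero_iff _ (chartToTorus_injective K _)).2 hg0
  rw [← rationalFunctionHom_apply, ← hgf, map_mul, Scheme.ord_mul
    (rationalFunction_ne_zero Δ (by simp)) (rationalFunction_ne_zero Δ hcg0),
    τ.ord_single_zsmul ht, τ.ord_chart hg0, Ring.ord_of_isUnit]
  · simp
  · exact IsLocalization.map_units (Localization.AtPrime (orbitIdeal K τ.1.1))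
      (⟨g, hgP⟩ : (orbitIdeal K τ.1.1).primeCompl)

omit [Module.Free ℤ N] [Module.Finite ℤ N] in
-- A half-space is convex, so a lower bound on the exponents holds on their hull; it is attained at
-- `m₀`.
theorem supportFunction_newtonPolytope {f : AddMonoidAlgebra K (CharLattice N)} {v : N}
    {m₀ : CharLattice N} (hm₀ : f.coeff m₀ ≠ 0) (hmin : ∀ m, f.coeff m ≠ 0 → m₀ v ≤ m v) :
    supportFunction (newtonPolytope f) (latticeMap v) = m₀ v := by
  refine IsLeast.csInf_eq ⟨⟨charReal m₀, subset_convexHull ℝ _ ⟨m₀, hm₀, rfl⟩,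
    charReal_latticeMap _ _⟩, ?_⟩
  rintro _ ⟨x, hx, rfl⟩
  have hconv : Convex ℝ {x : Module.Dual ℝ (NReal N) | (m₀ v : ℝ) ≤ x (latticeMap v)} :=
    convex_halfSpace_ge (f := fun x : Module.Dual ℝ (NReal N) => x (latticeMap v))
      ⟨fun _ _ => rfl, fun _ _ => rfl⟩ _
  refine convexHull_min ?_ hconv hx
  rintro _ ⟨m, hm, rfl⟩
  show (m₀ v : ℝ) ≤ charReal m (latticeMap v)
  rw [charReal_latticeMap]
  exact_mod_cast hmin m hm

end Divisor

/-! ### The cycle of the closure of `V(f)`. -/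

section Closure

variable {K : Type u} [Field K] {N : Type u} [AddCommGroup N] [Module.Free ℤ N]
  [Module.Finite ℤ N] (Δ : Fan N)

instance noetherianSpace_toricVariety : NoetherianSpace (toricVariety K Δ) := by
  have : Finite (chartCover K Δ).I₀ := inferInstanceAs (Finite Δ.Cone)
  have : ∀ i, CompactSpace ((chartCover K Δ).X i) := fun i =>
    inferInstanceAs (CompactSpace (Spec (CommRingCat.of (ChartRing K i.1))))
  have : CompactSpace (toricVariety K Δ) := (chartCover K Δ).compactSpace
  have : IsNoetherian (toricVariety K Δ) := {}
  infer_instance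

/-- For an immersion the map to the scheme-theoretic image is an open immersion, so the closure
keeps the local rings of `V(f)`. -/
instance isImmersion_zeroSchemeι (f : AddMonoidAlgebra K (CharLattice N)) :
    IsImmersion (zeroSchemeι Δ f) := by
  have : IsClosedImmersion (Spec.map (CommRingCat.ofHom (Ideal.Quotient.mk (Ideal.span {f})))) :=
    IsClosedImmersion.spec_of_surjective _ Ideal.Quotient.mk_surjective
  unfold zeroSchemeι
  infer_instance

variable {Δ}

/-- `V(f)` is open and dense in its closure, so it already contains the generic point of each
component. -/
theorem closureCycle_of_notMem_range {f : AddMonoidAlgebra K (CharLattice N)}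
    {x : toricVariety K Δ} (hx : x ∉ Set.range (zeroSchemeι Δ f)) : closureCycle Δ f x = 0 := by
  have := LocallyOfFiniteType.isLocallyNoetherian (zeroSchemeι Δ f).imageι
  by_cases hxi : x ∈ Set.range (zeroSchemeι Δ f).imageι
  · obtain ⟨z, rfl⟩ := hxi
    refine (pushforward_apply_of_isClosedImmersion _ _ z).trans (if_neg fun hz => hx ?_)
    have : NoetherianSpace (zeroSchemeι Δ f).image :=
      (zeroSchemeι Δ f).imageι.isClosedEmbedding.isInducing.noetherianSpace
    obtain ⟨w, rfl⟩ := mem_of_dense_of_maximal (zeroSchemeι Δ f).toImage.isOpenEmbedding.isOpen_range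
      (zeroSchemeι Δ f).toImage.denseRange ((mem_irreducibleComponents_closure_iff z).1 hz)
    refine ⟨w, ?_⟩
    conv_lhs => rw [← (zeroSchemeι Δ f).toImage_imageι]
    rfl
  · exact pushforward_apply_of_notMem_range _ _ x hxi

/-- The closure has at `q` the local ring `K[M]_p / (f)`, whose length is the order of `f`. What
remains is that `q` is a maximal point exactly when `p` has height one. -/
theorem closureCycle_zeroSchemeι_apply {f : AddMonoidAlgebra K (CharLattice N)} (hf : f ≠ 0)
    (q : Spec (CommRingCat.of (AddMonoidAlgebra K (CharLattice N) ⧸ Ideal.span {f}))) :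
    closureCycle Δ f (zeroSchemeι Δ f q) =
      Scheme.ord (rationalFunction Δ f) (zeroSchemeι Δ f q) := by
  classical
  have := LocallyOfFiniteType.isLocallyNoetherian (zeroSchemeι Δ f).imageι
  let R := AddMonoidAlgebra K (CharLattice N)
  have hdom : IsDomain (CommRingCat.of R) := isDomain_torusRing K
  have hnoeth : IsNoetherianRing R :=
    have := isNoetherianRing_chartRing K (Δ.rational _ Δ.zeroCone.2)
    isNoetherianRing_of_surjective _ _ (chartToTorus K Δ.zeroCone.1).toRingHom
      (chartToTorus_bot_bijective K).2
  let p : PrimeSpectrum R := PrimeSpectrum.comap (Ideal.Quotient.mk (Ideal.span {f})) q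
  have hfmem : ∀ q : PrimeSpectrum (R ⧸ Ideal.span {f}),
      f ∈ (PrimeSpectrum.comap (Ideal.Quotient.mk (Ideal.span {f})) q).asIdeal := by
    intro q
    show Ideal.Quotient.mk (Ideal.span {f}) f ∈ q.asIdeal
    rw [Ideal.Quotient.eq_zero_iff_mem.2 (Ideal.mem_span_singleton_self f)]
    exact zero_mem _
  have hfp : f ∈ p.asIdeal := hfmem q
  -- Krull bounds the height by one, and it is nonzero because `p` contains `f ≠ 0`. Conversely, no
  -- nonzero prime lies strictly below a height-one prime.
  have hminimal : p.asIdeal ∈ (Ideal.span {f}).minimalPrimes ↔ p.asIdeal.height = 1 := by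
    constructor
    · intro h
      refine le_antisymm (Ideal.height_le_one_of_isPrincipal_of_mem_minimalPrimes _ _ h) ?_
      rw [Order.one_le_iff_ne_zero, Ne, Ideal.height_eq_zero_iff_eq_bot]
      exact fun h0 => hf (by rwa [h0] at hfp)
    · intro h
      refine ⟨⟨p.isPrime, (Ideal.span_singleton_le_iff_mem _).2 hfp⟩, ?_⟩
      rintro P ⟨hP, hfP⟩ hPp
      have hP0 : P ≠ ⊥ := fun h0 => hf (by simpa [h0] using hfP)
      exact (eq_of_le_of_height_eq_one h hP hP0 hPp).ge
  have hx : zeroSchemeι Δ f q = torusι K Δ p := rfl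
  let j := (zeroSchemeι Δ f).toImage
  have hji : (zeroSchemeι Δ f).imageι (j q) = zeroSchemeι Δ f q := by
    conv_rhs => rw [← (zeroSchemeι Δ f).toImage_imageι]
    rfl
  have hcyc : closureCycle Δ f (zeroSchemeι Δ f q) = fundamentalCycle (zeroSchemeι Δ f).image (j q) := by
    rw [← hji]
    exact pushforward_apply_of_isClosedImmersion _ _ (j q)
  have hlen : Module.length ((zeroSchemeι Δ f).image.presheaf.stalk (j q))
      ((zeroSchemeι Δ f).image.presheaf.stalk (j q)) =
      Ring.ord (Localization.AtPrime p.asIdeal) (algebraMap R _ f) := by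
    rw [length_self_ringEquiv (stalkEquiv j q)]
    exact length_localization_quotient_span f q p rfl
  have hcoh : Order.coheight (torusι K Δ p) = p.asIdeal.height := coheight_chart (torusι K Δ) p
  have hle : p.asIdeal.height = 1 → ∀ y, y ⤳ j q → y = j q := by
    intro hp y hy
    -- A generization of `j q` stays in the open image of `j`, so the comparison takes place inside
    -- `V(f)`.
    obtain ⟨q', rfl⟩ := hy.mem_open j.isOpenEmbedding.isOpen_range ⟨q, rfl⟩
    have hq : q' ⤳ q := j.isOpenEmbedding.isInducing.specializes_iff.1 hy
    have hq' : q'.asIdeal ≤ q.asIdeal := (PrimeSpectrum.le_iff_specializes q' q).2 hq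
    refine congrArg j (PrimeSpectrum.comap_injective_of_surjective
      (Ideal.Quotient.mk (Ideal.span {f})) Ideal.Quotient.mk_surjective (le_antisymm ?_ ?_))
    · exact fun a ha => hq' ha
    · have hmin : p.asIdeal ∈ (Ideal.span {f}).minimalPrimes :=
        hminimal.2 hp
      refine hmin.2 ⟨(PrimeSpectrum.comap (Ideal.Quotient.mk (Ideal.span {f})) q').isPrime, ?_⟩
        fun a ha => hq' ha
      exact (Ideal.span_singleton_le_iff_mem _).2 (hfmem q')
  have hge : (∀ y, y ⤳ j q → y = j q) → p.asIdeal.height = 1 := by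
    intro h
    refine hminimal.1 ⟨⟨p.isPrime, (Ideal.span_singleton_le_iff_mem _).2 hfp⟩, ?_⟩
    rintro P ⟨hP, hfP⟩ hPp
    obtain ⟨q', hq'⟩ : (⟨P, hP⟩ : PrimeSpectrum R) ∈
        Set.range (PrimeSpectrum.comap (Ideal.Quotient.mk (Ideal.span {f}))) := by
      rw [range_comap_of_surjective _ _ Ideal.Quotient.mk_surjective, Ideal.mk_ker]
      exact hfP
    have hle' : q'.asIdeal ≤ q.asIdeal := by
      intro a ha
      obtain ⟨a, rfl⟩ := Ideal.Quotient.mk_surjective a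
      have : a ∈ (⟨P, hP⟩ : PrimeSpectrum R).asIdeal := hq' ▸ ha
      exact hPp this
    have hspec : j q' ⤳ j q :=
      ((PrimeSpectrum.le_iff_specializes q' q).1 hle').map j.continuous
    have heq : q' = q := j.isOpenEmbedding.injective (h _ hspec)
    have : p = ⟨P, hP⟩ := by rw [← hq', heq]
    rw [this]
  rw [hcyc]
  by_cases hp : p.asIdeal.height = 1
  · refine (if_pos ((mem_irreducibleComponents_closure_iff (j q)).2 (hle hp))).trans ?_
    rw [hlen, hx]
    exact (ord_chartFunction (R := CommRingCat.of R) (torusι K Δ) p hp hf).symm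
  · refine (if_neg fun h => hp (hge ((mem_irreducibleComponents_closure_iff (j q)).1 h))).trans ?_
    rw [Scheme.ord_eq_zero_of_coheight_neq_one]
    rw [hx, hcoh]
    exact hp

end Closure

/-! ### The divisor formula, coefficient by coefficient. -/

section DivisorFormula

variable {K : Type u} [Field K] {N : Type u} [AddCommGroup N] [Module.Free ℤ N]
  [Module.Finite ℤ N] {Δ : Fan N}

omit [Module.Free ℤ N] [Module.Finite ℤ N] in
theorem range_zeroSchemeι_subset (f : AddMonoidAlgebra K (CharLattice N)) :
    Set.range (zeroSchemeι Δ f) ⊆ Set.range (torusι K Δ) := by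
  rintro _ ⟨q, rfl⟩
  exact ⟨_, rfl⟩

/-- Off `V(f)` the function `f` is a unit in the local ring, so both sides vanish. -/
theorem ord_rationalFunction_torusι {f : AddMonoidAlgebra K (CharLattice N)} (hf : f ≠ 0)
    (p : PrimeSpectrum (AddMonoidAlgebra K (CharLattice N))) :
    Scheme.ord (rationalFunction Δ f) (torusι K Δ p) = closureCycle Δ f (torusι K Δ p) := by
  by_cases hfp : f ∈ p.asIdeal
  · obtain ⟨q, rfl⟩ : p ∈ Set.range (PrimeSpectrum.comap (Ideal.Quotient.mk (Ideal.span {f}))) := by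
      rw [range_comap_of_surjective _ _ Ideal.Quotient.mk_surjective, Ideal.mk_ker]
      exact (Ideal.span_singleton_le_iff_mem _).2 hfp
    exact (closureCycle_zeroSchemeι_apply hf q).symm
  · rw [closureCycle_of_notMem_range]
    · by_cases hp : p.asIdeal.height = 1
      · have : IsDomain (CommRingCat.of (AddMonoidAlgebra K (CharLattice N))) :=
          isDomain_torusRing K
        refine (ord_chartFunction (R := CommRingCat.of (AddMonoidAlgebra K (CharLattice N)))
          (torusι K Δ) p hp hf).trans ?_
        rw [Ring.ord_of_isUnit]
        · rfl
        · exact IsLocalization.map_units (Localization.AtPrime p.asIdeal)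
            (⟨f, hfp⟩ : p.asIdeal.primeCompl)
      · refine Scheme.ord_eq_zero_of_coheight_neq_one (fun h => hp ?_) _
        rw [← h]
        exact (coheight_chart (torusι K Δ) p).symm
    · rintro ⟨q, hq⟩
      have hq' : PrimeSpectrum.comap (Ideal.Quotient.mk (Ideal.span {f})) q = p :=
        (torusι K Δ).isOpenEmbedding.injective hq
      apply hfp
      rw [← hq']
      show Ideal.Quotient.mk (Ideal.span {f}) f ∈ q.asIdeal
      rw [Ideal.Quotient.eq_zero_iff_mem.2 (Ideal.mem_span_singleton_self f)]
      exact zero_mem _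

open Classical in
theorem cycleOfIrreducibleClosed_orbitClosure_apply (τ : Δ.Cone) (x : toricVariety K Δ) :
    cycleOfIrreducibleClosed (orbitClosure K Δ τ) x =
      if x = orbitGenericPoint K Δ τ then 1 else 0 := by
  have h : IsGenericPoint x (orbitClosure K Δ τ) ↔ x = orbitGenericPoint K Δ τ :=
    ⟨fun h => h.eq (isGenericPoint_orbitClosure K Δ τ),
      fun h => h ▸ isGenericPoint_orbitClosure K Δ τ⟩
  refine Eq.trans ?_ (if_congr h rfl rfl)
  show (if _ then _ else _) = _
  congr

/-- The divisor of a Laurent polynomial, for any multiplicities `c τ` equal to its orders along the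
boundary divisors. -/
theorem divisor_rationalFunction {f : AddMonoidAlgebra K (CharLattice N)} (hf : f ≠ 0)
    (c : Δ.Ray → ℤ)
    (hc : ∀ τ : Δ.Ray, Scheme.ord (rationalFunction Δ f) (orbitGenericPoint K Δ τ.1) = c τ) :
    divisor (rationalFunction Δ f) =
      closureCycle Δ f + ∑ τ, c τ • cycleOfIrreducibleClosed (orbitClosure K Δ τ.1) := by
  classical
  ext x
  have hsum : (∑ τ, c τ • cycleOfIrreducibleClosed (orbitClosure K Δ τ.1)) x =
      ∑ τ : Δ.Ray, if x = orbitGenericPoint K Δ τ.1 then c τ else 0 := by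
    rw [Function.locallyFinsuppWithin.coe_sum, Finset.sum_apply]
    refine Finset.sum_congr rfl fun τ _ => ?_
    rw [Function.locallyFinsuppWithin.coe_zsmul, Pi.smul_apply,
      cycleOfIrreducibleClosed_orbitClosure_apply, smul_eq_mul, mul_ite, mul_one, mul_zero]
  rw [Function.locallyFinsuppWithin.coe_add, Pi.add_apply, hsum]
  show Scheme.ord (rationalFunction Δ f) x = _
  -- Torus points see only the closure cycle, other points only the boundary. Distinct rays have
  -- distinct generic points, so at most one boundary term survives.
  by_cases hx : x ∈ Set.range (torusι K Δ)
  · obtain ⟨p, rfl⟩ := hx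
    rw [Finset.sum_eq_zero, add_zero]
    · exact ord_rationalFunction_torusι hf p
    · exact fun τ _ => if_neg fun h => τ.orbitGenericPoint_notMem_range_torusι ⟨p, h⟩
  · rw [closureCycle_of_notMem_range fun h => hx (range_zeroSchemeι_subset f h), zero_add]
    by_cases hcoh : Order.coheight x = 1
    · obtain ⟨τ, rfl⟩ := exists_ray_of_coheight_eq_one hcoh hx
      rw [hc, Finset.sum_eq_single τ]
      · rw [if_pos rfl]
      · exact fun σ _ hne => if_neg fun h =>
          hne (Subtype.ext (orbitGenericPoint_injective h)).symm
      · exact fun h => absurd (Finset.mem_univ τ) h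
    · rw [Scheme.ord_eq_zero_of_coheight_neq_one hcoh, Finset.sum_eq_zero]
      exact fun τ _ => if_neg fun h => hcoh (by rw [h]; exact τ.coheight_orbitGenericPoint)

end DivisorFormula

/-! ### Rational equivalence and the theorem. -/

theorem rationallyEquivalent_of_divisor {X : Scheme.{u}} [IsIntegral X] [IsLocallyNoetherian X]
    {r : X.functionField} (hr : r ≠ 0) {α β : AlgebraicCycle X ℤ} (h : divisor r = α - β) :
    RationallyEquivalent α β := by
  -- One generator suffices, with `W = X` and the identity as closed immersion.
  refine AddSubgroup.subset_closure ⟨X, 𝟙 X, inferInstance, inferInstance, inferInstance, r, hr, ?_⟩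
  rw [pushforward_id, h]

end Toric

theorem theorem4p3 {K : Type u} [Field K] {N : Type u} [AddCommGroup N] [Module.Free ℤ N]
    [Module.Finite ℤ N] (Δ : Toric.Fan N)
    (hproper : IsProper (Toric.structureMap K Δ)) (hsmooth : Smooth (Toric.structureMap K Δ))
    (f : AddMonoidAlgebra K (Toric.CharLattice N)) (hf : f ≠ 0) :
    ∃ c : Δ.Ray → ℤ,
      (∀ τ, (c τ : ℝ) =
        Toric.supportFunction (Toric.newtonPolytope f) (Toric.latticeMap τ.generator)) ∧
      Toric.divisor (Toric.rationalFunction Δ f) =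
        Toric.closureCycle Δ f +
          ∑ τ, c τ • Toric.cycleOfIrreducibleClosed (Toric.orbitClosure K Δ τ.1) ∧
      Toric.RationallyEquivalent (Toric.closureCycle Δ f)
        (-∑ τ, c τ • Toric.cycleOfIrreducibleClosed (Toric.orbitClosure K Δ τ.1)) := by
  have hsupp : f.coeff.support.Nonempty :=
    Finsupp.support_nonempty_iff.2 fun h => hf (AddMonoidAlgebra.coeff_eq_zero.1 h)
  -- For each ray, an exponent of `f` that is least on its generator; this least value is the
  -- integer `c τ`.
  choose m hm hmin using fun τ : Δ.Ray =>
    Finset.exists_min_image f.coeff.support (fun m => m τ.generator) hsupp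
  have hm' : ∀ τ, f.coeff (m τ) ≠ 0 := fun τ => Finsupp.mem_support_iff.1 (hm τ)
  have hmin' : ∀ τ p, f.coeff p ≠ 0 → m τ τ.generator ≤ p τ.generator := fun τ p hp =>
    hmin τ p (Finsupp.mem_support_iff.2 hp)
  have hdiv := Toric.divisor_rationalFunction hf (fun τ => m τ τ.generator) fun τ =>
    τ.ord_rationalFunction (K := K) (hm' τ) (hmin' τ)
  refine ⟨fun τ => m τ τ.generator, fun τ =>
    (Toric.supportFunction_newtonPolytope (hm' τ) (hmin' τ)).symm, hdiv, ?_⟩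
  exact Toric.rationallyEquivalent_of_divisor (Toric.rationalFunction_ne_zero Δ hf)
    (hdiv.trans (sub_neg_eq_add _ _).symm)
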